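/- Let $\phi:\mathbb R\to[0,+\infty]$ be convex and lower semicontinuous, with $\phi(1)=0$, $\phi(x)=+\infty$ for $x<0$, and $\phi$ finite on a neighborhood of $1$. Put $\phi'(\infty)=\lim_{x\to\infty}\phi(x)/x\in[0,\infty]$, $\psi(x)=\phi(x+1)$ and $\psi^\star(s)=\sup_{y\in\mathbb R}\{ys-\psi(y)\}$. For probability measures $\mu,\nu$ on a measurable space $(\Omega,\mathcal F)$, with Lebesgue decomposition $\mu=\mu_c+\mu_s$ with respect to $\nu$, let $$D_\phi(\mu\|\nu)=\int\phi\Big(\frac{d\mu_c}{d\nu}\Big)\,d\nu+\mu_s(\Omega)\,\phi'(\infty)\qquad(0\cdot\infty=0).$$ For a $\sigma$-ideal $\Xi\subseteq\mathcal F$ and measurable $f:\Omega\to\mathbb R$, the $\Xi$-essential range of $f$ is $\{x\in\mathbb R : f^{-1}((x-\varepsilon,x+\varepsilon))\notin\Xi\ \text{for all }\varepsilon>0\}$, $\operatorname{ess\,sup}_\Xi f$ is its supremum, and $f\in L^\infty(\Xi)$ means that it is bounded. A measure $\mu$ satisfies $\mu\ll\Xi$ if $|\mu|(A)=0$ for all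 $A\in\Xi$. For a probability measure $\nu\ll\Xi$ put $$K_{g,\nu,\Xi}(t)=\inf\Big\{\int\psi^\star(tg+\lambda)\,d\nu : \lambda\in\mathbb R,\ \lambda+\operatorname{ess\,sup}_\Xi(tg)\le\phi'(\infty)\Big\}\in[0,\infty],\qquad t\in\mathbb R,$$ and $\operatorname{dom}K=\{t: K(t)<\infty\}$. A function $g$ is called $(\phi,\nu)$-subexponential if $0$ lies in the interior of $\operatorname{dom}K_{g,\nu,N}$, where $N$ is the $\sigma$-ideal of $\nu$-null sets. **Theorem.** Assume that $1\notin\operatorname{int}\{x\in\mathbb R:\phi(x)=0\}$. Let $\Sigma\subseteq\mathcal F$ be a $\sigma$-ideal and $g:\Omega\to\mathbb R$ measurable. Let $X_g$ be the set of finite signed measures $\mu\ll\Sigma$ with $\int|g|\,d|\mu|<\infty$, let $X_g^1$ be the set of probability measures in $X_g$, let $\nu\in X_g^1$, and let $\Xi=\{A\in\mathcal F:\ |\mu|(A)=0\ \text{for all }\mu\in X_g\}$. Then the following are equivalent: 1. for every sequence $(\nu_n)$ of probability measures with $\nu_n\ll\Xi$, $D_\phi(\nu_n\|\nu)\to0$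 implies that $g$ is $\nu_n$-integrable for all sufficiently large $n$ and $\int g\,d\nu_n\to\int g\,d\nu$; 2. for every sequence $(\nu_n)$ in $X_g^1$, $D_\phi(\nu_n\|\nu)\to0$ implies $\int g\,d\nu_n\to\int g\,d\nu$; 3. the subdifferential $\partial K_{g,\nu,\Xi}(0)=\{s\in\mathbb R: K_{g,\nu,\Xi}(t)\ge K_{g,\nu,\Xi}(0)+st\ \text{for all }t\in\mathbb R\}$ equals $\{0\}$; 4. $K_{g,\nu,\Xi}$ is finite near $0$ and differentiable at $0$ with $K_{g,\nu,\Xi}'(0)=0$; 5. $0$ lies in the interior of $\operatorname{dom}K_{g,\nu,\Xi}$; 6. $g\in L^\infty(\Xi)$ if $\phi'(\infty)<\infty$, and $g$ is $(\phi,\nu)$-subexponential if $\phi'(\infty)=\infty$. -/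

import Mathlib

open MeasureTheory Filter Topology
open scoped ENNReal NNReal

noncomputable section

namespace PhiDivergence

/-! ### Convex analysis on the real line -/

/-- The convex conjugate `f*(s) = sup_y (y s - f y)` of an extended real valued function. -/
def conjugate (f : ℝ → EReal) (s : ℝ) : EReal :=
  ⨆ y : ℝ, (((y * s : ℝ) : EReal) - f y)

/-- The subdifferential `∂f(a) = {s : ∀ t, f t ≥ f a + s (t - a)}`. -/
def subdifferential (f : ℝ → EReal) (a : ℝ) : Set ℝ :=
  {s : ℝ | ∀ t : ℝ, f a + ((s * (t - a) : ℝ) : EReal) ≤ f t}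

/-- `φ'(∞) = lim_{x → ∞} φ(x) / x`, in `[0, ∞]`. For a convex `φ` with `φ 1 = 0` the limit exists,
hence equals the limit superior. -/
def slopeAtTop (φ : ℝ → ℝ≥0∞) : ℝ≥0∞ :=
  limsup (fun x : ℝ => φ x / ENNReal.ofReal x) atTop

/-- The conjugate `ψ*` of `ψ(x) = φ(x + 1)`. -/
def psiConj (φ : ℝ → ℝ≥0∞) : ℝ → EReal :=
  conjugate fun x => (φ (x + 1) : EReal)

variable {Ω : Type*} [MeasurableSpace Ω]

/-- The `φ`-divergence `D_φ(μ ‖ ν) = ∫ φ(dμ_c/dν) dν + μ_s(Ω) φ'(∞)` of probability measures, where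
`μ = μ_c + μ_s` is the Lebesgue decomposition of `μ` with respect to `ν` (and `0 * ∞ = 0`). -/
def phiDiv (φ : ℝ → ℝ≥0∞) (μ ν : ProbabilityMeasure Ω) : ℝ≥0∞ :=
  ∫⁻ ω, φ ((μ : Measure Ω).rnDeriv (ν : Measure Ω) ω).toReal ∂(ν : Measure Ω)
    + (μ : Measure Ω).singularPart (ν : Measure Ω) Set.univ * slopeAtTop φ

/-! ### σ-ideals of measurable sets -/

/-- A `σ`-ideal of the `σ`-algebra of `Ω`: a family of measurable sets containing `∅` and closed
under measurable subsets and countable unions. -/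
structure SigmaIdeal (Ω : Type*) [MeasurableSpace Ω] where
  sets : Set (Set Ω)
  measurableSet_of_mem : ∀ A ∈ sets, MeasurableSet A
  empty_mem : ∅ ∈ sets
  subset_mem : ∀ A B : Set Ω, MeasurableSet A → A ⊆ B → B ∈ sets → A ∈ sets
  iUnion_mem : ∀ A : ℕ → Set Ω, (∀ n, A n ∈ sets) → (⋃ n, A n) ∈ sets

/-- The `σ`-ideal of measurable `ν`-null sets. -/
def nullIdeal (ν : Measure Ω) : SigmaIdeal Ω where
  sets := {A | MeasurableSet A ∧ ν A = 0}
  measurableSet_of_mem := fun _ h => h.1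
  empty_mem := ⟨MeasurableSet.empty, measure_empty⟩
  subset_mem := fun _ _ hA hAB hB => ⟨hA, measure_mono_null hAB hB.2⟩
  iUnion_mem := fun _ h =>
    ⟨MeasurableSet.iUnion fun n => (h n).1, measure_iUnion_null fun n => (h n).2⟩

/-- The `σ`-ideal of the measurable sets that are null for all (finite signed) measures in `X`. -/
def commonNullIdeal (X : Set (SignedMeasure Ω)) : SigmaIdeal Ω where
  sets := {A | MeasurableSet A ∧ ∀ μ ∈ X, μ.totalVariation A = 0}
  measurableSet_of_mem := fun _ h => h.1
  empty_mem := ⟨MeasurableSet.empty, fun _ _ => measure_empty⟩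
  subset_mem := fun _ _ hA hAB hB => ⟨hA, fun μ hμ => measure_mono_null hAB (hB.2 μ hμ)⟩
  iUnion_mem := fun _ h =>
    ⟨MeasurableSet.iUnion fun n => (h n).1,
      fun μ hμ => measure_iUnion_null fun n => (h n).2 μ hμ⟩

/-- The `Ξ`-essential range of `f`. -/
def essRange (Ξ : SigmaIdeal Ω) (f : Ω → ℝ) : Set ℝ :=
  {x : ℝ | ∀ ε : ℝ, 0 < ε → f ⁻¹' Set.Ioo (x - ε) (x + ε) ∉ Ξ.sets}

/-- The `Ξ`-essential supremum of `f`, an extended real number. -/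
def esssup (Ξ : SigmaIdeal Ω) (f : Ω → ℝ) : EReal :=
  ⨆ x ∈ essRange Ξ f, (x : EReal)

/-- `f ∈ L^∞(Ξ)` (for measurable `f`): the `Ξ`-essential range of `f` is bounded. -/
def EssBounded (Ξ : SigmaIdeal Ω) (f : Ω → ℝ) : Prop :=
  Bornology.IsBounded (essRange Ξ f)

/-- The probability measures `μ ≪ Ξ`, i.e. those vanishing on every member of `Ξ`. -/
def acProb (Ξ : SigmaIdeal Ω) : Set (ProbabilityMeasure Ω) :=
  {μ | ∀ A ∈ Ξ.sets, (μ : Measure Ω) A = 0}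

/-! ### The space `X_g` -/

/-- `X_g`: the finite signed measures `μ ≪ S` with `|μ|(|g|) < ∞`. -/
def integratingMeasures (S : SigmaIdeal Ω) (g : Ω → ℝ) : Set (SignedMeasure Ω) :=
  {μ | (∀ A ∈ S.sets, μ.totalVariation A = 0) ∧ ∫⁻ ω, ‖g ω‖ₑ ∂μ.totalVariation < ∞}

/-- `X_g^1`: the probability measures in `X_g`. -/
def integratingProbs (S : SigmaIdeal Ω) (g : Ω → ℝ) : Set (ProbabilityMeasure Ω) :=
  {μ | (μ : Measure Ω).toSignedMeasure ∈ integratingMeasures S g}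

/-! ### Cumulant generating functions -/

/-- The `(φ, ν, Ξ)`-cumulant generating function
`K_{g,ν,Ξ}(t) = inf {ν(ψ*(t g + l)) : l ∈ ℝ, l + esssup_Ξ (t g) ≤ φ'(∞)}`.
For `φ ≥ 0` with `φ 1 = 0` the function `ψ*` is nonnegative, so that passing to `[0, ∞]` under the
integral sign loses nothing. -/
def cgf (φ : ℝ → ℝ≥0∞) (g : Ω → ℝ) (ν : ProbabilityMeasure Ω) (Ξ : SigmaIdeal Ω) (t : ℝ) : ℝ≥0∞ :=
  ⨅ (l : ℝ) (_ : (l : EReal) + esssup Ξ (fun ω => t * g ω) ≤ (slopeAtTop φ : EReal)),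
    ∫⁻ ω, (psiConj φ (t * g ω + l)).toENNReal ∂(ν : Measure Ω)

/-- The effective domain of a `[0, ∞]`-valued function. -/
def effDom (K : ℝ → ℝ≥0∞) : Set ℝ :=
  {t : ℝ | K t < ∞}

/-- `g` is `(φ, ν)`-subexponential: `0` is interior to the domain of `K_{g,ν} = K_{g,ν,N}`, where
`N` is the `σ`-ideal of `ν`-null sets. -/
def Subexponential (φ : ℝ → ℝ≥0∞) (ν : ProbabilityMeasure Ω) (g : Ω → ℝ) : Prop :=
  (0 : ℝ) ∈ interior (effDom (cgf φ g ν (nullIdeal (ν : Measure Ω))))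

/-- The extended real valued `K` is finite around `a` and differentiable there with derivative
`d`. -/
def HasFiniteDerivAt (K : ℝ → ℝ≥0∞) (d a : ℝ) : Prop :=
  (∀ᶠ t in 𝓝 a, K t < ∞) ∧ HasDerivAt (fun t => (K t).toReal) d a

end PhiDivergence

end

/-! The engine for upper bounds is Young's inequality `(x - 1) s ≤ φ x + ψ*(s)`. Integrated with `s
= t g + l`, where `s ≤ φ'(∞)` off `Ξ` controls the singular part, it gives `t (∫ g dμ - ∫ g dν) ≤
D_φ(μ‖ν) + K(t)`, as the constant `l` cancels between probability measures. So convergence of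
integrals follows once `K(±t) = o(t)` as `t ↓ 0`, which is also `K'(0) = 0`.

Condition 6 yields `K(±t) = o(t)`: on one side `σ = ±1` of `1` the function `φ` is positive, hence
`ψ*(σ s) = o(s)` as `s ↓ 0`, and the shift `l = σ t M` moves `t g + l` to that side. For bounded `g`
the move is complete (`exists_cgf_le_of_essBounded`). If `φ'(∞) = ∞`, the part left over vanishes as
`M → ∞`, and monotone convergence of difference quotients finishes
(`exists_cgf_le_of_slope_eq_top`).

If 6 fails, a small mass `ρ` is mixed into `ν` with `∫ g dρ ≥ 1` (or the same for `-g`) and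
divergence tending to `0` (`exists_not_tendsto`). For finite slope, `ρ` is a multiple of a measure
living where `g` is large; for infinite slope, its density is a multiple of `breakEven φ (t g)`, at
which the cost in `φ` is at most the gain `t g` per unit of mass while `∫ ψ*(t g) dν = ∞` makes the
total gain unbounded.

The implications run 1 → 2 → 6 → 1 and 6 → 4 → 3 → 5 → 6. -/

noncomputable section

namespace PhiDivergence

/-! ### Convexity of `φ` around its zero at `1` -/

section Scaling

variable {φ : ℝ → ℝ≥0∞}

/-- A convex function vanishing at `1` is star-shaped around `1`. -/
theorem apply_one_add_mul_le (hφ : ConvexOn ℝ≥0 Set.univ φ) (h1 : φ 1 = 0) {θ : ℝ} (h0 : 0 ≤ θ)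
    (hθ : θ ≤ 1) (y : ℝ) : φ (1 + θ * y) ≤ ENNReal.ofReal θ * φ (1 + y) := by
  obtain ⟨-, hφ⟩ := hφ
  have h1θ : 0 ≤ 1 - θ := sub_nonneg.2 hθ
  have h := hφ (Set.mem_univ (1 + y)) (Set.mem_univ 1) (a := θ.toNNReal) (b := (1 - θ).toNNReal)
    zero_le zero_le (by rw [← Real.toNNReal_add h0 h1θ]; simp)
  simp only [NNReal.smul_def, Real.coe_toNNReal _ h0, Real.coe_toNNReal _ h1θ, smul_eq_mul, h1,
    smul_zero, add_zero, ENNReal.smul_def] at h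
  rw [show θ * (1 + y) + (1 - θ) * 1 = 1 + θ * y by ring] at h
  exact h

/-- Chord slopes from `1` increase, multiplied out so that infinite values are harmless. Taking `σ =
±1` treats both sides of `1` at once. -/
theorem apply_one_add_mul_ge (hφ : ConvexOn ℝ≥0 Set.univ φ) (h1 : φ 1 = 0) {y z : ℝ} {σ : ℝ} (hy : 0 < y)
    (hyz : y ≤ z) : ENNReal.ofReal (z / y) * φ (1 + σ * y) ≤ φ (1 + σ * z) := by
  have hz : 0 < z := hy.trans_le hyz
  have h := apply_one_add_mul_le hφ h1 (θ := y / z) (by positivity) ((div_le_one hz).2 hyz) (σ * z)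
  rw [show y / z * (σ * z) = σ * y by field_simp] at h
  calc _ ≤ ENNReal.ofReal (z / y) * (ENNReal.ofReal (y / z) * φ (1 + σ * z)) := by gcongr
    _ = _ := by
      rw [← mul_assoc, ← ENNReal.ofReal_mul (by positivity)]
      rw [show z / y * (y / z) = 1 by field_simp]; simp

/-- Between `1 - m` and `1 + r`, a convex function vanishing at `1` is at most the sum of its values
at the end points. -/
theorem apply_one_sub_add_le (hφ : ConvexOn ℝ≥0 Set.univ φ) (h1 : φ 1 = 0) {m r : ℝ} (hm : 0 ≤ m)
    (hr : 0 ≤ r) : φ (1 - m + r) ≤ φ (1 - m) + φ (1 + r) := by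
  have key : ∀ a b : ℝ, 0 ≤ a → a ≤ b → ∀ σ : ℝ, φ (1 + σ * a) ≤ φ (1 + σ * b) := by
    intro a b ha hab σ
    rcases ha.eq_or_lt with rfl | ha
    · simp [h1]
    · refine le_trans ?_ (apply_one_add_mul_ge hφ h1 (σ := σ) ha hab)
      refine le_mul_of_one_le_left zero_le ?_
      rw [ENNReal.one_le_ofReal]
      exact (one_le_div ha).2 hab
  rcases le_total m r with h | h
  · have := key (r - m) r (by linarith) (by linarith) 1
    rw [show 1 - m + r = 1 + 1 * (r - m) by ring]
    exact this.trans (by rw [one_mul]; exact le_add_self)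
  · have := key (m - r) m (by linarith) (by linarith) (-1)
    rw [show 1 - m + r = 1 + (-1) * (m - r) by ring]
    exact this.trans (by rw [show 1 + -1 * m = 1 - m by ring]; exact le_self_add)

/-- The chord to a finite value on the left of `1` gives a linear bound. Here `m n` will be the mass
taken away from `ν`. -/
theorem tendsto_apply_one_sub (hφ : ConvexOn ℝ≥0 Set.univ φ) (h1 : φ 1 = 0)
    (hdom : (1 : ℝ) ∈ interior {x : ℝ | φ x < ∞}) {m : ℕ → ℝ} (hm0 : ∀ n, 0 ≤ m n)
    (hm : Tendsto m atTop (𝓝 0)) : Tendsto (fun n => φ (1 - m n)) atTop (𝓝 0) := by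
  obtain ⟨ε, hε, hb⟩ := Metric.mem_nhds_iff.1 (mem_interior_iff_mem_nhds.1 hdom)
  have hfin : φ (1 + -(ε / 2)) < ∞ := hb (by
    rw [Metric.mem_ball, Real.dist_eq, show 1 + -(ε / 2) - 1 = -(ε / 2) by ring, abs_neg, abs_of_pos]
      <;> linarith)
  have hlim : Tendsto (fun n => ENNReal.ofReal (m n / (ε / 2)) * φ (1 + -(ε / 2))) atTop
      (𝓝 0) := by
    have : Tendsto (fun n => ENNReal.ofReal (m n / (ε / 2))) atTop (𝓝 0) := by
      simpa using ENNReal.tendsto_ofReal (hm.div_const (ε / 2))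
    simpa using ENNReal.Tendsto.mul_const this (Or.inr hfin.ne)
  refine tendsto_of_tendsto_of_tendsto_of_le_of_le' tendsto_const_nhds hlim
    (Eventually.of_forall fun _ => zero_le) ?_
  filter_upwards [hm.eventually_lt_const (half_pos hε)] with n hn
  have h := apply_one_add_mul_le hφ h1 (θ := m n / (ε / 2)) (div_nonneg (hm0 n) (by linarith))
    ((div_le_one (by linarith)).2 hn.le) (-(ε / 2))
  rwa [show 1 + m n / (ε / 2) * -(ε / 2) = 1 - m n by field_simp; ring] at h

/-- On one side of `1`, `φ` is positive. -/
theorem exists_sign_pos (hφ : ConvexOn ℝ≥0 Set.univ φ) (h1 : φ 1 = 0)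
    (hzero : (1 : ℝ) ∉ interior {x : ℝ | φ x = 0}) :
    ∃ σ : ℝ, (σ = 1 ∨ σ = -1) ∧ ∀ y : ℝ, 0 < y → 0 < φ (1 + σ * y) := by
  by_contra! hcon
  obtain ⟨a, ha, ha'⟩ := hcon 1 (Or.inl rfl)
  obtain ⟨b, hb, hb'⟩ := hcon (-1) (Or.inr rfl)
  have ha0 : φ (1 + 1 * a) = 0 := le_antisymm ha' zero_le
  have hb0 : φ (1 + -1 * b) = 0 := le_antisymm hb' zero_le
  refine hzero (mem_interior_iff_mem_nhds.2 ?_)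
  filter_upwards [Ioo_mem_nhds (show 1 - b < 1 by linarith) (show 1 < 1 + a by linarith)] with x hx
  have key : ∀ σ y z : ℝ, 0 < z → z ≤ y → φ (1 + σ * y) = 0 → φ (1 + σ * z) = 0 := by
    intro σ y z hz hzy h0
    have h := apply_one_add_mul_ge hφ h1 (σ := σ) hz hzy
    rw [h0, nonpos_iff_eq_zero, mul_eq_zero] at h
    refine h.resolve_left ?_
    rw [ENNReal.ofReal_eq_zero, not_le]
    have := hz.trans_le hzy
    positivity
  rcases lt_trichotomy x 1 with h | rfl | h
  · have := key (-1) b (1 - x) (by linarith) (by linarith [hx.1]) hb0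
    rwa [show 1 + -1 * (1 - x) = x by ring] at this
  · exact h1
  · have := key 1 a (x - 1) (by linarith) (by linarith [hx.2]) ha0
    rwa [show 1 + 1 * (x - 1) = x by ring] at this

end Scaling

/-! ### The slope of `φ` at infinity -/

section Slope

variable {φ : ℝ → ℝ≥0∞}

/-- Chord slopes from `1` increase, and their limit is `φ'(∞)`. -/
theorem apply_one_add_le_slope (hφ : ConvexOn ℝ≥0 Set.univ φ) (h1 : φ 1 = 0) {y : ℝ} (hy : 0 ≤ y) :
    φ (1 + y) ≤ ENNReal.ofReal y * slopeAtTop φ := by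
  rcases hy.eq_or_lt with rfl | hy
  · simp [h1]
  have hq : φ (1 + y) / ENNReal.ofReal y ≤ slopeAtTop φ := by
    -- The factor `(x - 1) / x → 1` converts the chord slope `φ x / (x - 1)` into `φ x / x`, which
    -- defines `slopeAtTop`.
    have hlim : Tendsto (fun x : ℝ => φ (1 + y) / ENNReal.ofReal y * ENNReal.ofReal ((x - 1) / x))
        atTop (𝓝 (φ (1 + y) / ENNReal.ofReal y)) := by
      have h : Tendsto (fun x : ℝ => (x - 1) / x) atTop (𝓝 1) := by
        have h2 : Tendsto (fun x : ℝ => 1 - x⁻¹) atTop (𝓝 (1 - 0)) :=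
          tendsto_const_nhds.sub tendsto_inv_atTop_zero
        rw [sub_zero] at h2
        refine h2.congr' ?_
        filter_upwards [eventually_gt_atTop 0] with x hx
        field_simp
      have h3 := ENNReal.tendsto_ofReal h
      rw [ENNReal.ofReal_one] at h3
      simpa using ENNReal.Tendsto.const_mul (a := φ (1 + y) / ENNReal.ofReal y) h3 (Or.inl one_ne_zero)
    rw [← hlim.limsup_eq]
    refine limsup_le_limsup ?_
    filter_upwards [eventually_ge_atTop (1 + y)] with x hx
    have hs := apply_one_add_mul_ge hφ h1 (σ := 1) hy (show y ≤ x - 1 by linarith)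
    rw [one_mul, one_mul, add_sub_cancel] at hs
    have hx0 : 0 < x := by linarith
    rw [ENNReal.le_div_iff_mul_le (by simp [hx0]) (by simp)]
    refine le_trans (le_of_eq ?_) hs
    rw [div_eq_mul_inv, ← ENNReal.ofReal_inv_of_pos hy, mul_assoc, mul_assoc,
      ← ENNReal.ofReal_mul (div_nonneg (by linarith) hx0.le), ← ENNReal.ofReal_mul (by positivity),
      mul_comm]
    congr 2
    field_simp
  rw [ENNReal.div_le_iff (by simp [hy]) (by simp)] at hq
  rwa [mul_comm]

/-- One point with quotient above `C` suffices: chord slopes only grow beyond it. -/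
theorem exists_mul_le_of_slope_eq_top (hφ : ConvexOn ℝ≥0 Set.univ φ) (h1 : φ 1 = 0)
    (hc : slopeAtTop φ = ∞) (C : ℝ) :
    ∃ z : ℝ, 0 < z ∧ ∀ y, z ≤ y → ENNReal.ofReal (C * y) ≤ φ (1 + y) := by
  have hlt : ENNReal.ofReal C < limsup (fun x : ℝ => φ x / ENNReal.ofReal x) atTop := by
    change _ < slopeAtTop φ
    rw [hc]; exact ENNReal.ofReal_lt_top
  obtain ⟨x, hx, hx2⟩ :=
    ((frequently_lt_of_lt_limsup (by isBoundedDefault) hlt).and_eventually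
      (eventually_gt_atTop 1)).exists
  refine ⟨x - 1, by linarith, fun y hy => ?_⟩
  rw [ENNReal.lt_div_iff_mul_lt (by simp) (by simp)] at hx
  have hs := apply_one_add_mul_ge hφ h1 (σ := 1) (show 0 < x - 1 by linarith) hy
  rw [one_mul, one_mul, add_sub_cancel] at hs
  refine le_trans ?_ hs
  have hy0 : 0 < y := by linarith
  have hx1 : 0 < x - 1 := by linarith
  calc ENNReal.ofReal (C * y) = ENNReal.ofReal (y / (x - 1)) * (ENNReal.ofReal C * ENNReal.ofReal (x - 1)) := by
        rw [← ENNReal.ofReal_mul' hx1.le, ← ENNReal.ofReal_mul (by positivity)]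
        congr 1; field_simp
    _ ≤ ENNReal.ofReal (y / (x - 1)) * (ENNReal.ofReal C * ENNReal.ofReal x) := by
        gcongr; linarith
    _ ≤ _ := by gcongr

end Slope

/-! ### The conjugate `ψ*` -/

section Conj

variable {φ : ℝ → ℝ≥0∞}

/-- `ψ*` as a function with values in `[0, ∞]`. -/
def psiStar (φ : ℝ → ℝ≥0∞) (s : ℝ) : ℝ≥0∞ :=
  (psiConj φ s).toENNReal

/-- Replaces the supremum in `EReal` by inequalities in `[0, ∞]`; truncating at `0` is harmless
because `C ≥ 0`. -/
theorem psiStar_le_iff {s : ℝ} {C : ℝ≥0∞} :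
    psiStar φ s ≤ C ↔ ∀ y : ℝ, ENNReal.ofReal (y * s) ≤ φ (y + 1) + C := by
  have hC : (0 : EReal) ≤ (C : EReal) := EReal.coe_ennreal_nonneg C
  have e : psiStar φ s ≤ C ↔ psiConj φ s ≤ (C : EReal) := by
    rw [psiStar]
    constructor
    · intro h
      refine le_trans ?_ (EReal.coe_ennreal_le_coe_ennreal_iff.2 h)
      rw [EReal.coe_toENNReal_eq_max]
      exact le_max_right _ _
    · intro h
      simpa using EReal.toENNReal_le_toENNReal h
  rw [e, psiConj, conjugate, iSup_le_iff]
  refine forall_congr' fun y => ?_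
  rw [EReal.sub_le_iff_le_add (Or.inl (EReal.coe_ennreal_ne_bot _)) (Or.inr (by
    intro h; simp [h] at hC)), ← EReal.coe_ennreal_add, add_comm C]
  constructor
  · intro h
    have := EReal.toENNReal_le_toENNReal h
    rwa [EReal.toENNReal_coe, EReal.toENNReal_of_ne_top (EReal.coe_ne_top _), EReal.toReal_coe]
      at this
  · intro h
    refine le_trans ?_ (EReal.coe_ennreal_le_coe_ennreal_iff.2 h)
    rw [EReal.coe_ennreal_ofReal]
    exact_mod_cast le_max_left _ _

theorem young (s y : ℝ) : ENNReal.ofReal (y * s) ≤ φ (y + 1) + psiStar φ s :=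
  psiStar_le_iff.1 le_rfl y

theorem psiStar_zero : psiStar φ 0 = 0 :=
  le_antisymm (psiStar_le_iff.2 fun y => by simp) zero_le

theorem psiStar_mul_le {θ : ℝ} (h0 : 0 ≤ θ) (hθ : θ ≤ 1) (s : ℝ) :
    psiStar φ (θ * s) ≤ ENNReal.ofReal θ * psiStar φ s := by
  refine psiStar_le_iff.2 fun y => ?_
  rw [show y * (θ * s) = θ * (y * s) by ring, ENNReal.ofReal_mul h0]
  calc _ ≤ ENNReal.ofReal θ * (φ (y + 1) + psiStar φ s) := by gcongr; exact young s y
    _ ≤ _ := by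
      rw [mul_add]
      gcongr
      exact mul_le_of_le_one_left zero_le (by simpa using hθ)

/-- A weak form of midpoint convexity. It serves to exchange one additive shift for another at the
price of halving `t`. -/
theorem psiStar_half_add_le (s s' : ℝ) :
    psiStar φ (2⁻¹ * s + 2⁻¹ * s') ≤ psiStar φ s + psiStar φ s' := by
  refine psiStar_le_iff.2 fun y => ?_
  have h : ∀ u : ℝ, ENNReal.ofReal (2⁻¹ * (y * u)) ≤ 2⁻¹ * φ (y + 1) + psiStar φ u := by
    intro u
    rw [ENNReal.ofReal_mul (by norm_num), ENNReal.ofReal_inv_of_pos (by norm_num),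
      ENNReal.ofReal_ofNat]
    calc _ ≤ 2⁻¹ * (φ (y + 1) + psiStar φ u) := by gcongr; exact young u y
      _ ≤ _ := by
        rw [mul_add]
        gcongr
        exact mul_le_of_le_one_left zero_le (by simp)
  rw [show y * (2⁻¹ * s + 2⁻¹ * s') = 2⁻¹ * (y * s) + 2⁻¹ * (y * s') by ring]
  calc _ ≤ _ := ENNReal.ofReal_add_le
    _ ≤ _ := add_le_add (h s) (h s')
    _ = (2⁻¹ + 2⁻¹) * φ (y + 1) + (psiStar φ s + psiStar φ s') := by ring
    _ = _ := by rw [ENNReal.inv_two_add_inv_two, one_mul]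

/-- Only `y ≥ -1` counts in the supremum, and there `y s ≤ -s`. -/
theorem psiStar_le_neg (hneg : ∀ x : ℝ, x < 0 → φ x = ∞) {s : ℝ} (hs : s ≤ 0) :
    psiStar φ s ≤ ENNReal.ofReal (-s) := by
  refine psiStar_le_iff.2 fun y => ?_
  rcases lt_or_ge (y + 1) 0 with h | h
  · simp [hneg _ h]
  · exact le_add_left (ENNReal.ofReal_le_ofReal (by nlinarith))

/-- Superlinear growth of `φ` beats `y s` beyond some `z`; on `[-1, z]` the linear term is bounded.
-/
theorem psiStar_lt_top (hφ : ConvexOn ℝ≥0 Set.univ φ) (h1 : φ 1 = 0)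
    (hneg : ∀ x : ℝ, x < 0 → φ x = ∞) (hc : slopeAtTop φ = ∞) (s : ℝ) : psiStar φ s < ∞ := by
  obtain ⟨z, hz, h⟩ := exists_mul_le_of_slope_eq_top hφ h1 hc |s|
  suffices hb : psiStar φ s ≤ ENNReal.ofReal ((z + 1) * |s|) from hb.trans_lt ENNReal.ofReal_lt_top
  refine psiStar_le_iff.2 fun y => ?_
  rcases lt_or_ge (y + 1) 0 with h0 | h0
  · simp [hneg _ h0]
  rcases le_total z y with hy | hy
  · refine le_add_right (le_trans (ENNReal.ofReal_le_ofReal ?_) (add_comm y 1 ▸ h y hy))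
    rw [mul_comm]
    exact mul_le_mul_of_nonneg_right (le_abs_self s) (by linarith)
  · refine le_add_left (ENNReal.ofReal_le_ofReal ((le_abs_self _).trans ?_))
    rw [abs_mul]
    gcongr
    rw [abs_le]
    constructor <;> linarith

@[fun_prop]
theorem measurable_psiStar : Measurable (psiStar φ) := by
  refine measurable_of_Iic fun C => IsClosed.measurableSet ?_
  have : psiStar φ ⁻¹' Set.Iic C = ⋂ y : ℝ, {s : ℝ | ENNReal.ofReal (y * s) ≤ φ (y + 1) + C} := by
    ext s
    simp [psiStar_le_iff]
  rw [this]
  exact isClosed_iInter fun y => isClosed_le (ENNReal.continuous_ofReal.comp (by fun_prop)) continuous_const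

/-- If `φ` is positive on the `σ`-side of `1`, then `ψ*(σ s) = o(s)` as `s ↓ 0`. -/
theorem exists_psiStar_le (hφ : ConvexOn ℝ≥0 Set.univ φ) (h1 : φ 1 = 0) {σ : ℝ}
    (hσ : σ = 1 ∨ σ = -1) (hpos : ∀ y : ℝ, 0 < y → 0 < φ (1 + σ * y)) {ε : ℝ} (hε : 0 < ε) :
    ∃ δ : ℝ, 0 < δ ∧ ∀ s : ℝ, 0 ≤ s → s ≤ δ → psiStar φ (σ * s) ≤ ENNReal.ofReal (ε * s) := by
  -- `δ` bounds from below the chord slope at distance `ε` from `1`. Nearer points contribute at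
  -- most `ε s`; farther ones are absorbed by `φ` as soon as `s ≤ δ`.
  obtain ⟨δ, hδ, hδ'⟩ : ∃ δ : ℝ, 0 < δ ∧ ENNReal.ofReal (ε * δ) ≤ φ (1 + σ * ε) := by
    rcases eq_or_ne (φ (1 + σ * ε)) ∞ with h | h
    · exact ⟨1, one_pos, by simp [h]⟩
    · refine ⟨(φ (1 + σ * ε)).toReal / ε, div_pos (ENNReal.toReal_pos (hpos ε hε).ne' h) hε, ?_⟩
      rw [mul_div_cancel₀ _ hε.ne', ENNReal.ofReal_toReal h]
  have hσ2 : σ * σ = 1 := by rcases hσ with rfl | rfl <;> norm_num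
  refine ⟨δ, hδ, fun s hs hsδ => psiStar_le_iff.2 fun y => ?_⟩
  rcases le_total (σ * y) ε with hy | hy
  · refine le_add_left (ENNReal.ofReal_le_ofReal ?_)
    nlinarith
  · refine le_add_right ?_
    have h := apply_one_add_mul_ge hφ h1 (σ := σ) hε hy
    rw [← mul_assoc, hσ2, one_mul, add_comm 1 y] at h
    refine le_trans ?_ h
    have hy0 : 0 < σ * y := by linarith
    calc ENNReal.ofReal (y * (σ * s)) ≤ ENNReal.ofReal (σ * y / ε) * ENNReal.ofReal (ε * δ) := by
          rw [← ENNReal.ofReal_mul (by positivity)]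
          refine ENNReal.ofReal_le_ofReal ?_
          rw [show σ * y / ε * (ε * δ) = σ * y * δ by field_simp,
            show y * (σ * s) = σ * y * s by ring]
          gcongr
      _ ≤ _ := by gcongr

end Conj

variable {Ω : Type*} [MeasurableSpace Ω]

/-! ### Essential range and essential supremum relative to a `σ`-ideal -/

section Ideal

variable {Ξ : SigmaIdeal Ω} {f : Ω → ℝ}

theorem SigmaIdeal.biUnion_mem {ι : Type*} {T : Set ι} (hT : T.Countable) {A : ι → Set Ω}
    (h : ∀ i ∈ T, A i ∈ Ξ.sets) : (⋃ i ∈ T, A i) ∈ Ξ.sets := by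
  rcases T.eq_empty_or_nonempty with rfl | hne
  · simpa using Ξ.empty_mem
  · obtain ⟨u, rfl⟩ := hT.exists_eq_range hne
    rw [Set.biUnion_range]
    exact Ξ.iUnion_mem _ fun n => h _ (Set.mem_range_self n)

theorem SigmaIdeal.union_mem {A B : Set Ω} (hA : A ∈ Ξ.sets) (hB : B ∈ Ξ.sets) :
    A ∪ B ∈ Ξ.sets := by
  have h := SigmaIdeal.biUnion_mem (Ξ := Ξ) (T := (Set.univ : Set Bool)) (Set.to_countable _)
    (A := fun b => cond b A B) (by rintro (_ | _) - <;> assumption)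
  rwa [Set.biUnion_univ, ← Set.union_eq_iUnion] at h

/-- By the Lindelöf property, countably many of the intervals with preimage in `Ξ` cover `U`. -/
theorem preimage_mem_iff (hf : Measurable f) {U : Set ℝ} (hU : IsOpen U) :
    f ⁻¹' U ∈ Ξ.sets ↔ ∀ x ∈ essRange Ξ f, x ∉ U := by
  constructor
  · intro h x hx hxU
    obtain ⟨ε, hε, hb⟩ := Metric.isOpen_iff.1 hU x hxU
    rw [Real.ball_eq_Ioo] at hb
    exact hx ε hε (Ξ.subset_mem _ _ (hf measurableSet_Ioo) (Set.preimage_mono hb) h)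
  · intro h
    have h2 : ∀ x : U, ∃ ε : ℝ, 0 < ε ∧ f ⁻¹' Set.Ioo (x - ε) (x + ε) ∈ Ξ.sets := by
      rintro ⟨x, hx⟩
      by_contra! hcon
      exact h x hcon hx
    choose ε hε hmem using h2
    obtain ⟨T, hT, hTU⟩ := TopologicalSpace.isOpen_iUnion_countable
      (fun x : U => Set.Ioo ((x : ℝ) - ε x) (x + ε x)) fun _ => isOpen_Ioo
    refine Ξ.subset_mem _ _ (hf hU.measurableSet) ?_ (SigmaIdeal.biUnion_mem hT fun i _ => hmem i)
    rw [← Set.preimage_iUnion₂, hTU]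
    refine Set.preimage_mono fun x hx => Set.mem_iUnion.2 ⟨⟨x, hx⟩, ?_⟩
    have := hε ⟨x, hx⟩
    constructor <;> simp [this]

theorem esssup_le_iff (hf : Measurable f) (B : ℝ) :
    esssup Ξ f ≤ (B : EReal) ↔ {ω | B < f ω} ∈ Ξ.sets := by
  rw [show {ω | B < f ω} = f ⁻¹' Set.Ioi B from rfl, preimage_mem_iff hf isOpen_Ioi]
  simp [esssup, iSup_le_iff]

/-- Turns the constraint on `l` into membership in `Ξ`; for `c = ∞` both sides hold trivially. -/
theorem add_esssup_le_iff (hf : Measurable f) (l : ℝ) (c : ℝ≥0∞) :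
    (l : EReal) + esssup Ξ f ≤ (c : EReal) ↔ {ω | c < ENNReal.ofReal (f ω + l)} ∈ Ξ.sets := by
  rcases eq_or_ne c ∞ with rfl | hc
  · simp [Ξ.empty_mem]
  · lift c to ℝ≥0 using hc
    have h1 : (l : EReal) + esssup Ξ f ≤ (((c : ℝ≥0) : ℝ≥0∞) : EReal) ↔
        esssup Ξ f ≤ ((c - l : ℝ) : EReal) := by
      rw [EReal.coe_sub, EReal.le_sub_iff_add_le (Or.inl (EReal.coe_ne_bot _))
        (Or.inl (EReal.coe_ne_top _)), add_comm]
      rfl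
    rw [h1, esssup_le_iff hf]
    have h2 : {ω | (c : ℝ) - l < f ω} = {ω | (c : ℝ≥0∞) < ENNReal.ofReal (f ω + l)} := by
      ext ω
      simp only [Set.mem_ofPred_eq, ENNReal.ofReal, ENNReal.coe_lt_coe, Real.lt_toNNReal_iff_coe_lt,
        sub_lt_iff_lt_add]
    rw [h2]

theorem essBounded_iff (hf : Measurable f) :
    EssBounded Ξ f ↔ ∃ M : ℝ, 0 < M ∧ {ω | M < |f ω|} ∈ Ξ.sets := by
  have h : ∀ M : ℝ, {ω | M < |f ω|} ∈ Ξ.sets ↔ ∀ x ∈ essRange Ξ f, ‖x‖ ≤ M := fun M => by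
    rw [show {ω | M < |f ω|} = f ⁻¹' {x | M < |x|} from rfl,
      preimage_mem_iff hf (isOpen_lt continuous_const continuous_abs)]
    simp
  simp only [h]
  rw [EssBounded, isBounded_iff_forall_norm_le]
  exact ⟨fun ⟨M, hM⟩ => ⟨max M 1, by positivity, fun x hx => (hM x hx).trans (le_max_left _ _)⟩,
    fun ⟨M, _, hM⟩ => ⟨M, hM⟩⟩

theorem essBounded_of_sides (hf : Measurable f) {M M' : ℝ} (h : {ω | M < f ω} ∈ Ξ.sets)
    (h' : {ω | M' < -f ω} ∈ Ξ.sets) : EssBounded Ξ f := by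
  refine (essBounded_iff hf).2 ⟨max 1 (max M M'), by positivity,
    Ξ.subset_mem _ _ (measurableSet_lt measurable_const hf.abs) ?_ (SigmaIdeal.union_mem h h')⟩
  intro ω hω
  rw [Set.mem_ofPred_eq, max_lt_iff, max_lt_iff] at hω
  rcases abs_choice (f ω) with h1 | h1 <;> rw [h1] at hω
  · exact Or.inl hω.2.1
  · exact Or.inr hω.2.2

end Ideal

/-! ### The cumulant generating function -/

section Cgf

variable {φ : ℝ → ℝ≥0∞} {g : Ω → ℝ} {ν : ProbabilityMeasure Ω} {Ξ : SigmaIdeal Ω}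

theorem cgf_eq (hg : Measurable g) (t : ℝ) : cgf φ g ν Ξ t =
    ⨅ (l : ℝ) (_ : {ω | slopeAtTop φ < ENNReal.ofReal (t * g ω + l)} ∈ Ξ.sets),
      ∫⁻ ω, psiStar φ (t * g ω + l) ∂(ν : Measure Ω) := by
  simp only [cgf, add_esssup_le_iff (hg.const_mul t), psiStar]

theorem cgf_le (hg : Measurable g) {t l : ℝ}
    (h : {ω | slopeAtTop φ < ENNReal.ofReal (t * g ω + l)} ∈ Ξ.sets) :
    cgf φ g ν Ξ t ≤ ∫⁻ ω, psiStar φ (t * g ω + l) ∂(ν : Measure Ω) := by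
  rw [cgf_eq hg]
  exact iInf₂_le l h

theorem exists_of_cgf_lt (hg : Measurable g) {t : ℝ} {a : ℝ≥0∞} (h : cgf φ g ν Ξ t < a) :
    ∃ l : ℝ, {ω | slopeAtTop φ < ENNReal.ofReal (t * g ω + l)} ∈ Ξ.sets ∧
      ∫⁻ ω, psiStar φ (t * g ω + l) ∂(ν : Measure Ω) < a := by
  rw [cgf_eq hg] at h
  simpa [iInf_lt_iff] using h

/-- Reduces negative arguments to positive ones, with `-g` in place of `g`. -/
theorem cgf_neg (t : ℝ) : cgf φ (fun ω => -g ω) ν Ξ t = cgf φ g ν Ξ (-t) := by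
  simp [cgf]

theorem cgf_zero (hg : Measurable g) : cgf φ g ν Ξ 0 = 0 := by
  refine le_antisymm ((cgf_le hg (l := 0) ?_).trans ?_) zero_le
  · simpa using Ξ.empty_mem
  · simp [psiStar_zero]

/-- If `l` is admissible for `t`, then `θ l` is admissible for `θ t`, because `φ'(∞) ≥ 0`; then
`psiStar_mul_le` applies pointwise. -/
theorem cgf_mul_le (hg : Measurable g) {θ : ℝ} (h0 : 0 ≤ θ) (hθ : θ ≤ 1) (t : ℝ) :
    cgf φ g ν Ξ (θ * t) ≤ ENNReal.ofReal θ * cgf φ g ν Ξ t := by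
  rcases h0.eq_or_lt with rfl | h0
  · simp [cgf_zero hg]
  have h0' : ENNReal.ofReal θ ≠ 0 := by simpa using h0
  rw [cgf_eq hg t, ENNReal.mul_iInf_of_ne h0' ENNReal.ofReal_ne_top]
  refine le_iInf fun l => ?_
  rw [ENNReal.mul_iInf_of_ne h0' ENNReal.ofReal_ne_top]
  refine le_iInf fun hl => ?_
  refine (cgf_le hg (l := θ * l) (Ξ.subset_mem _ _ ?_ ?_ hl)).trans ?_
  · exact measurableSet_lt measurable_const (by fun_prop)
  · intro ω hω
    rw [Set.mem_ofPred_eq] at hω ⊢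
    refine hω.trans_le ?_
    rw [show θ * t * g ω + θ * l = θ * (t * g ω + l) by ring, ENNReal.ofReal_mul h0.le]
    exact mul_le_of_le_one_left zero_le (by simpa using hθ)
  · rw [← lintegral_const_mul _ (by fun_prop)]
    refine lintegral_mono fun ω => ?_
    rw [show θ * t * g ω + θ * l = θ * (t * g ω + l) by ring]
    exact psiStar_mul_le h0.le hθ _

/-- A linear bound at a single `t` passes to all smaller arguments, so `K(t) = o(t)` can be stated
with one `t` for each `ε`. -/
theorem cgf_le_of_le (hg : Measurable g) {t ε : ℝ} (ht : 0 < t)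
    (h : cgf φ g ν Ξ t ≤ ENNReal.ofReal (ε * t)) {s : ℝ} (h0 : 0 ≤ s) (hs : s ≤ t) :
    cgf φ g ν Ξ s ≤ ENNReal.ofReal (ε * s) := by
  have h2 := cgf_mul_le (φ := φ) (ν := ν) (Ξ := Ξ) hg (θ := s / t) (by positivity)
    ((div_le_one ht).2 hs) t
  rw [div_mul_cancel₀ _ ht.ne'] at h2
  calc _ ≤ _ := h2
    _ ≤ ENNReal.ofReal (s / t) * ENNReal.ofReal (ε * t) := by gcongr
    _ = _ := by
      rw [← ENNReal.ofReal_mul (by positivity)]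
      congr 1
      field_simp

theorem cgf_lt_top_of_le (hg : Measurable g) {t : ℝ} (ht : 0 < t) (h : cgf φ g ν Ξ t < ∞) {s : ℝ}
    (h0 : 0 ≤ s) (hs : s ≤ t) : cgf φ g ν Ξ s < ∞ := by
  refine (cgf_le_of_le (ε := (cgf φ g ν Ξ t).toReal / t) hg ht ?_ h0 hs).trans_lt
    ENNReal.ofReal_lt_top
  rw [div_mul_cancel₀ _ ht.ne', ENNReal.ofReal_toReal h.ne]

theorem mem_interior_effDom_iff (hg : Measurable g) :
    (0 : ℝ) ∈ interior (effDom (cgf φ g ν Ξ)) ↔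
      (∃ t : ℝ, 0 < t ∧ cgf φ g ν Ξ t < ∞) ∧ ∃ t : ℝ, 0 < t ∧ cgf φ g ν Ξ (-t) < ∞ := by
  rw [mem_interior_iff_mem_nhds]
  constructor
  · intro h
    obtain ⟨ε, hε, h⟩ := Metric.mem_nhds_iff.1 h
    rw [Real.ball_eq_Ioo] at h
    exact ⟨⟨ε / 2, by linarith, h (by constructor <;> linarith)⟩,
      ⟨ε / 2, by linarith, h (by constructor <;> linarith)⟩⟩
  · rintro ⟨⟨t, ht, h1⟩, ⟨t', ht', h2⟩⟩
    filter_upwards [Ioo_mem_nhds (neg_lt_zero.2 ht') ht] with s hs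
    rcases le_total 0 s with h | h
    · exact cgf_lt_top_of_le hg ht h1 h hs.2.le
    · rw [← cgf_neg] at h2
      have h3 := cgf_lt_top_of_le hg.neg ht' h2 (s := -s) (by linarith) (by linarith [hs.1])
      change cgf φ (fun ω => -g ω) ν Ξ (-s) < ∞ at h3
      rwa [cgf_neg, neg_neg] at h3

/-- With infinite slope the constraint is void and the ideal drops out; this links `Subexponential`,
stated with `ν`-null sets, to `Ξ`. -/
theorem cgf_eq_of_slope_eq_top (hc : slopeAtTop φ = ∞) (Ξ' : SigmaIdeal Ω) :
    cgf φ g ν Ξ = cgf φ g ν Ξ' := by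
  ext t
  simp [cgf, hc]

end Cgf

/-! ### The space `X_g` -/

section Space

variable {S : SigmaIdeal Ω} {g : Ω → ℝ}

theorem totalVariation_toSignedMeasure (μ : Measure Ω) [IsFiniteMeasure μ] :
    μ.toSignedMeasure.totalVariation = μ := by
  rw [SignedMeasure.totalVariation_eq_variation, Measure.variation_toSignedMeasure]

theorem mem_integratingProbs_iff {μ : ProbabilityMeasure Ω} : μ ∈ integratingProbs S g ↔
    (∀ A ∈ S.sets, (μ : Measure Ω) A = 0) ∧ ∫⁻ ω, ‖g ω‖ₑ ∂(μ : Measure Ω) < ∞ := by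
  simp [integratingProbs, integratingMeasures, totalVariation_toSignedMeasure]

theorem integrable_of_mem (hg : Measurable g) {μ : ProbabilityMeasure Ω}
    (hμ : μ ∈ integratingProbs S g) : Integrable g (μ : Measure Ω) :=
  ⟨hg.aestronglyMeasurable, (mem_integratingProbs_iff.1 hμ).2⟩

theorem integratingMeasures_neg :
    integratingMeasures S (fun ω => -g ω) = integratingMeasures S g := by
  simp [integratingMeasures]

theorem integratingProbs_subset_acProb :
    integratingProbs S g ⊆ acProb (commonNullIdeal (integratingMeasures S g)) := by
  intro μ hμ A hA
  simpa [totalVariation_toSignedMeasure] using hA.2 _ hμ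

/-- Some `|μ|` with `μ ∈ X_g` charges `A`; conditioning it on `A` only restricts and rescales. -/
theorem exists_probabilityMeasure_of_notMem {A : Set Ω} (hA : MeasurableSet A)
    (h : A ∉ (commonNullIdeal (integratingMeasures S g)).sets) :
    ∃ ρ : Measure Ω, IsProbabilityMeasure ρ ∧ (∀ B ∈ S.sets, ρ B = 0) ∧
      ∫⁻ ω, ‖g ω‖ₑ ∂ρ < ∞ ∧ ∀ᵐ ω ∂ρ, ω ∈ A := by
  obtain ⟨μ, hμ, hμA⟩ : ∃ μ ∈ integratingMeasures S g, μ.totalVariation A ≠ 0 := by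
    by_contra! hcon
    exact h ⟨hA, hcon⟩
  have : IsFiniteMeasure μ.totalVariation := by
    rw [SignedMeasure.totalVariation]; infer_instance
  refine ⟨ProbabilityTheory.cond μ.totalVariation A,
    ProbabilityTheory.cond_isProbabilityMeasure hμA, fun B hB => ?_, ?_, ?_⟩
  · exact ProbabilityTheory.cond_absolutelyContinuous (hμ.1 B hB)
  · rw [ProbabilityTheory.cond, lintegral_smul_measure, smul_eq_mul]
    exact ENNReal.mul_lt_top (ENNReal.inv_lt_top.2 (pos_iff_ne_zero.2 hμA))
      ((setLIntegral_le_lintegral _ _).trans_lt hμ.2)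
  · exact (Measure.ae_smul_measure (ae_restrict_mem hA) _)

end Space

/-! ### Young's inequality, pointwise and integrated -/

section Young

variable {φ : ℝ → ℝ≥0∞}

theorem young_posPart (x s : ℝ) (hx : 0 ≤ x) :
    ENNReal.ofReal x * ENNReal.ofReal s ≤ φ x + psiStar φ s + ENNReal.ofReal s := by
  have h := young (φ := φ) s (x - 1)
  rw [sub_add_cancel] at h
  calc ENNReal.ofReal x * ENNReal.ofReal s
      = ENNReal.ofReal (x * s) := (ENNReal.ofReal_mul hx).symm
    _ = ENNReal.ofReal ((x - 1) * s + s) := by ring_nf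
    _ ≤ _ := ENNReal.ofReal_add_le
    _ ≤ _ := by gcongr

/-- `(x - 1) s ≤ φ x + ψ*(s)` with positive and negative parts of `s` moved so that every term is
nonnegative; it can then be integrated without integrability assumptions. -/
theorem young_parts (x s : ℝ) (hx : 0 ≤ x) :
    ENNReal.ofReal x * ENNReal.ofReal s + ENNReal.ofReal (-s) ≤
      φ x + psiStar φ s + ENNReal.ofReal s + ENNReal.ofReal x * ENNReal.ofReal (-s) := by
  rcases le_total 0 s with hs | hs
  · have := young_posPart (φ := φ) x s hx
    simpa [ENNReal.ofReal_of_nonpos (neg_nonpos.2 hs)] using this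
  · have h := young (φ := φ) s (x - 1)
    rw [sub_add_cancel] at h
    rw [ENNReal.ofReal_of_nonpos hs, mul_zero, zero_add, add_zero, ← ENNReal.ofReal_mul hx]
    calc ENNReal.ofReal (-s) = ENNReal.ofReal ((x - 1) * s + x * -s) := by ring_nf
      _ ≤ _ := ENNReal.ofReal_add_le
      _ ≤ _ := by gcongr

theorem lintegral_eq_singularPart_add (μ ν : Measure Ω) [IsFiniteMeasure μ] [IsFiniteMeasure ν]
    {F : Ω → ℝ≥0∞} (hF : Measurable F) : ∫⁻ ω, F ω ∂μ =
      ∫⁻ ω, F ω ∂μ.singularPart ν + ∫⁻ ω, ENNReal.ofReal (μ.rnDeriv ν ω).toReal * F ω ∂ν := by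
  conv_lhs => rw [Measure.haveLebesgueDecomposition_add μ ν]
  rw [lintegral_add_measure,
    lintegral_withDensity_eq_lintegral_mul _ (Measure.measurable_rnDeriv μ ν) hF]
  congr 1
  refine lintegral_congr_ae ?_
  filter_upwards [Measure.rnDeriv_lt_top μ ν] with ω hω
  simp [ENNReal.ofReal_toReal hω.ne]

variable {μ ν : ProbabilityMeasure Ω} {s : Ω → ℝ}

/-- This is where the constraint in `K` acts: singular mass is charged `φ'(∞)` per unit in the
divergence. -/
theorem lintegral_singularPart_le (hc : ∀ᵐ ω ∂(μ : Measure Ω), ENNReal.ofReal (s ω) ≤ slopeAtTop φ) :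
    ∫⁻ ω, ENNReal.ofReal (s ω) ∂(μ : Measure Ω).singularPart (ν : Measure Ω) ≤
      (μ : Measure Ω).singularPart (ν : Measure Ω) Set.univ * slopeAtTop φ := by
  rw [mul_comm, ← lintegral_const]
  refine lintegral_mono_ae ?_
  exact (Measure.absolutelyContinuous_of_le (Measure.singularPart_le _ _)).ae_le hc

theorem lintegral_posPart_le (hφ : Measurable φ) (hs : Measurable s)
    (hc : ∀ᵐ ω ∂(μ : Measure Ω), ENNReal.ofReal (s ω) ≤ slopeAtTop φ) :
    ∫⁻ ω, ENNReal.ofReal (s ω) ∂(μ : Measure Ω) ≤ phiDiv φ μ ν +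
      ∫⁻ ω, psiStar φ (s ω) ∂(ν : Measure Ω) + ∫⁻ ω, ENNReal.ofReal (s ω) ∂(ν : Measure Ω) := by
  have hm := ((μ : Measure Ω).measurable_rnDeriv (ν : Measure Ω)).ennreal_toReal
  rw [lintegral_eq_singularPart_add (μ : Measure Ω) (ν : Measure Ω) (by fun_prop), phiDiv]
  calc _ ≤ (μ : Measure Ω).singularPart (ν : Measure Ω) Set.univ * slopeAtTop φ +
        ∫⁻ ω, (φ ((μ : Measure Ω).rnDeriv (ν : Measure Ω) ω).toReal + psiStar φ (s ω) +
          ENNReal.ofReal (s ω)) ∂(ν : Measure Ω) :=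
        add_le_add (lintegral_singularPart_le hc)
          (lintegral_mono fun ω => young_posPart _ _ ENNReal.toReal_nonneg)
    _ = _ := by
      rw [lintegral_add_left (by fun_prop), lintegral_add_left (by fun_prop)]
      ring

theorem lintegral_young (hφ : Measurable φ) (hs : Measurable s)
    (hc : ∀ᵐ ω ∂(μ : Measure Ω), ENNReal.ofReal (s ω) ≤ slopeAtTop φ) :
    ∫⁻ ω, ENNReal.ofReal (s ω) ∂(μ : Measure Ω) + ∫⁻ ω, ENNReal.ofReal (-s ω) ∂(ν : Measure Ω) ≤
      phiDiv φ μ ν + ∫⁻ ω, psiStar φ (s ω) ∂(ν : Measure Ω) +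
        ∫⁻ ω, ENNReal.ofReal (s ω) ∂(ν : Measure Ω) +
        ∫⁻ ω, ENNReal.ofReal (-s ω) ∂(μ : Measure Ω) := by
  have hm := ((μ : Measure Ω).measurable_rnDeriv (ν : Measure Ω)).ennreal_toReal
  rw [lintegral_eq_singularPart_add (μ : Measure Ω) (ν : Measure Ω)
      (F := fun ω => ENNReal.ofReal (s ω)) (by fun_prop),
    lintegral_eq_singularPart_add (μ : Measure Ω) (ν : Measure Ω)
      (F := fun ω => ENNReal.ofReal (-s ω)) (by fun_prop), phiDiv, add_assoc,
    ← lintegral_add_left (by fun_prop)]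
  calc _ ≤ (μ : Measure Ω).singularPart (ν : Measure Ω) Set.univ * slopeAtTop φ +
        ∫⁻ ω, (φ ((μ : Measure Ω).rnDeriv (ν : Measure Ω) ω).toReal + psiStar φ (s ω) +
          ENNReal.ofReal (s ω) + ENNReal.ofReal ((μ : Measure Ω).rnDeriv (ν : Measure Ω) ω).toReal *
            ENNReal.ofReal (-s ω)) ∂(ν : Measure Ω) :=
        add_le_add (lintegral_singularPart_le hc)
          (lintegral_mono fun ω => young_parts _ _ ENNReal.toReal_nonneg)
    _ ≤ ∫⁻ ω, ENNReal.ofReal (-s ω) ∂(μ : Measure Ω).singularPart (ν : Measure Ω) + _ := le_add_self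
    _ = _ := by
      rw [lintegral_add_left (by fun_prop), lintegral_add_left (by fun_prop),
        lintegral_add_left (by fun_prop)]
      ring

theorem integral_sub_le (hφ : Measurable φ) (hs : Measurable s)
    (hc : ∀ᵐ ω ∂(μ : Measure Ω), ENNReal.ofReal (s ω) ≤ slopeAtTop φ)
    (hμ : Integrable s (μ : Measure Ω)) (hν : Integrable s (ν : Measure Ω)) {C : ℝ} (hC : 0 ≤ C)
    (h : phiDiv φ μ ν + ∫⁻ ω, psiStar φ (s ω) ∂(ν : Measure Ω) ≤ ENNReal.ofReal C) :
    ∫ ω, s ω ∂(μ : Measure Ω) - ∫ ω, s ω ∂(ν : Measure Ω) ≤ C := by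
  have hy := lintegral_young (ν := ν) hφ hs hc
  have hy := hy.trans (add_le_add_left (add_le_add_left h _) _)
  have e : ∀ κ : Measure Ω, Integrable s κ → ∫⁻ ω, ENNReal.ofReal (s ω) ∂κ ≠ ∞ ∧
      ∫⁻ ω, ENNReal.ofReal (-s ω) ∂κ ≠ ∞ := fun κ hκ =>
    ⟨hκ.lintegral_lt_top.ne, hκ.neg.lintegral_lt_top.ne⟩
  obtain ⟨a1, a2⟩ := e _ hμ
  obtain ⟨b1, b2⟩ := e _ hν
  rw [integral_eq_lintegral_pos_part_sub_lintegral_neg_part hμ,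
    integral_eq_lintegral_pos_part_sub_lintegral_neg_part hν]
  have := ENNReal.toReal_mono (by finiteness) hy
  rw [ENNReal.toReal_add a1 b2, ENNReal.toReal_add (by finiteness) a2,
    ENNReal.toReal_add (by finiteness) b1, ENNReal.toReal_ofReal hC] at this
  linarith

end Young

/-! ### From smallness of `K` to convergence of integrals -/

section Convergence

variable {φ : ℝ → ℝ≥0∞} {g : Ω → ℝ} {ν : ProbabilityMeasure Ω} {Ξ : SigmaIdeal Ω}

theorem ae_le_of_mem_acProb {μ : ProbabilityMeasure Ω} (hμ : μ ∈ acProb Ξ) {s : Ω → ℝ} {c : ℝ≥0∞}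
    (h : {ω | c < ENNReal.ofReal (s ω)} ∈ Ξ.sets) :
    ∀ᵐ ω ∂(μ : Measure Ω), ENNReal.ofReal (s ω) ≤ c := by
  rw [ae_iff]
  simpa using hμ _ h

/-- Young's inequality bounds `(t g + l)⁺` under `μ`, and `g` differs from this by a scaling and a
constant. -/
theorem lintegral_posPart_lt_top (hφ : Measurable φ) (hg : Measurable g)
    (hν : Integrable g (ν : Measure Ω)) {t : ℝ} (ht : 0 < t) (hK : cgf φ g ν Ξ t < ∞)
    {μ : ProbabilityMeasure Ω} (hμ : μ ∈ acProb Ξ) (hD : phiDiv φ μ ν < ∞) :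
    ∫⁻ ω, ENNReal.ofReal (g ω) ∂(μ : Measure Ω) < ∞ := by
  obtain ⟨l, hl, hl'⟩ := exists_of_cgf_lt hg hK
  have h := lintegral_posPart_le (ν := ν) hφ (by fun_prop) (ae_le_of_mem_acProb hμ hl)
  have h2 : ∫⁻ ω, ENNReal.ofReal (t * g ω + l) ∂(ν : Measure Ω) < ∞ :=
    ((hν.const_mul t).add (integrable_const l)).lintegral_lt_top
  have h3 := h.trans_lt (ENNReal.add_lt_top.2 ⟨ENNReal.add_lt_top.2 ⟨hD, hl'⟩, h2⟩)
  have h4 : ∫⁻ ω, ENNReal.ofReal (g ω) ∂(μ : Measure Ω) ≤ ENNReal.ofReal t⁻¹ *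
      (∫⁻ ω, ENNReal.ofReal (t * g ω + l) ∂(μ : Measure Ω) + ENNReal.ofReal (-l)) := by
    have : ∫⁻ _, ENNReal.ofReal (-l) ∂(μ : Measure Ω) = ENNReal.ofReal (-l) := by simp
    rw [← this, ← lintegral_add_left (by fun_prop), ← lintegral_const_mul _ (by fun_prop)]
    refine lintegral_mono fun ω => ?_
    calc ENNReal.ofReal (g ω) = ENNReal.ofReal (t⁻¹ * (t * g ω + l + -l)) := by
          congr 1; field_simp; ring
      _ = ENNReal.ofReal t⁻¹ * ENNReal.ofReal (t * g ω + l + -l) :=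
          ENNReal.ofReal_mul (by positivity)
      _ ≤ _ := by gcongr; exact ENNReal.ofReal_add_le
  exact h4.trans_lt (by finiteness)

theorem integrable_of_phiDiv_lt_top (hφ : Measurable φ) (hg : Measurable g)
    (hν : Integrable g (ν : Measure Ω)) {t : ℝ} (ht : 0 < t) (hK : cgf φ g ν Ξ t < ∞)
    {t' : ℝ} (ht' : 0 < t') (hK' : cgf φ g ν Ξ (-t') < ∞) {μ : ProbabilityMeasure Ω} (hμ : μ ∈ acProb Ξ)
    (hD : phiDiv φ μ ν < ∞) : Integrable g (μ : Measure Ω) := by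
  have h1 := lintegral_posPart_lt_top hφ hg hν ht hK hμ hD
  have h2 := lintegral_posPart_lt_top hφ hg.neg hν.neg ht' (by rwa [← cgf_neg] at hK') hμ hD
  refine ⟨hg.aestronglyMeasurable, ?_⟩
  refine lt_of_le_of_lt (lintegral_mono fun ω => ?_)
    ((lintegral_add_left hg.ennreal_ofReal _).trans_lt (ENNReal.add_lt_top.2 ⟨h1, h2⟩))
  rw [Real.enorm_eq_ofReal_abs]
  rcases le_total 0 (g ω) with h | h
  · rw [abs_of_nonneg h]; exact le_self_add
  · rw [abs_of_nonpos h]; exact le_add_self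

theorem eventually_integral_le (hφ : Measurable φ) (hg : Measurable g)
    (hν : Integrable g (ν : Measure Ω))
    (hK : ∀ ε : ℝ, 0 < ε → ∃ t : ℝ, 0 < t ∧ cgf φ g ν Ξ t ≤ ENNReal.ofReal (ε * t))
    {νs : ℕ → ProbabilityMeasure Ω} (hνs : ∀ n, νs n ∈ acProb Ξ)
    (hint : ∀ᶠ n in atTop, Integrable g (νs n : Measure Ω))
    (hD : Tendsto (fun n => phiDiv φ (νs n) ν) atTop (𝓝 0)) {ε : ℝ} (hε : 0 < ε) :
    ∀ᶠ n in atTop, ∫ ω, g ω ∂(νs n : Measure Ω) ≤ ∫ ω, g ω ∂(ν : Measure Ω) + ε := by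
  obtain ⟨t, ht, hKt⟩ := hK (ε / 3) (by positivity)
  -- Budget `ε t`: a near-optimal shift costs less than `2 ε t / 3` and the divergence takes the
  -- last third.
  obtain ⟨l, hl, hl'⟩ := exists_of_cgf_lt (a := ENNReal.ofReal (2 * ε / 3 * t)) hg
    (hKt.trans_lt ((ENNReal.ofReal_lt_ofReal_iff (by positivity)).2 (by
      have := mul_pos hε ht; linarith)))
  filter_upwards [hint, hD.eventually_lt_const (u := ENNReal.ofReal (ε / 3 * t))
    (by simp only [ENNReal.ofReal_pos]; positivity)] with n hn hn'
  have h := integral_sub_le hφ (by fun_prop) (ae_le_of_mem_acProb (hνs n) hl)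
    ((hn.const_mul t).add (integrable_const l)) ((hν.const_mul t).add (integrable_const l))
    (C := ε / 3 * t + 2 * ε / 3 * t) (by positivity) (by
      rw [ENNReal.ofReal_add (by positivity) (by positivity)]
      exact add_le_add hn'.le hl'.le)
  have e : ∀ κ : ProbabilityMeasure Ω, Integrable g (κ : Measure Ω) →
      ∫ ω, (t * g ω + l) ∂(κ : Measure Ω) = t * ∫ ω, g ω ∂(κ : Measure Ω) + l := by
    intro κ hκ
    rw [integral_add (hκ.const_mul t) (integrable_const l), integral_const_mul]
    simp
  rw [e _ hn, e _ hν] at h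
  have : t * ∫ ω, g ω ∂(νs n : Measure Ω) ≤ t * (∫ ω, g ω ∂(ν : Measure Ω) + ε) := by linarith
  exact le_of_mul_le_mul_left this ht

theorem tendsto_integral_of_phiDiv (hφ : Measurable φ) (hg : Measurable g)
    (hν : Integrable g (ν : Measure Ω))
    (hK : ∀ ε : ℝ, 0 < ε → ∃ t : ℝ, 0 < t ∧ cgf φ g ν Ξ t ≤ ENNReal.ofReal (ε * t))
    (hK' : ∀ ε : ℝ, 0 < ε → ∃ t : ℝ, 0 < t ∧ cgf φ g ν Ξ (-t) ≤ ENNReal.ofReal (ε * t))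
    {νs : ℕ → ProbabilityMeasure Ω} (hνs : ∀ n, νs n ∈ acProb Ξ)
    (hint : ∀ᶠ n in atTop, Integrable g (νs n : Measure Ω))
    (hD : Tendsto (fun n => phiDiv φ (νs n) ν) atTop (𝓝 0)) :
    Tendsto (fun n => ∫ ω, g ω ∂(νs n : Measure Ω)) atTop (𝓝 (∫ ω, g ω ∂(ν : Measure Ω))) := by
  rw [Metric.tendsto_atTop']
  intro ε hε
  have h1 := eventually_integral_le hφ hg hν hK hνs hint hD (half_pos hε)
  have h2 := eventually_integral_le hφ hg.neg hν.neg (by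
    intro ε hε
    obtain ⟨t, ht, h⟩ := hK' ε hε
    exact ⟨t, ht, by rwa [← cgf_neg] at h⟩) hνs (hint.mono fun n hn => hn.neg) hD (half_pos hε)
  obtain ⟨N, hN⟩ := eventually_atTop.1 (h1.and h2)
  refine ⟨N, fun n hn => ?_⟩
  obtain ⟨h3, h4⟩ := hN n hn.le
  simp only [Pi.neg_apply, integral_neg] at h4
  rw [Real.dist_eq, abs_lt]
  constructor <;> linarith

end Convergence

/-! ### Perturbing `ν` by a small mass -/

section Mixture

variable {φ : ℝ → ℝ≥0∞} {g : Ω → ℝ} {ν : ProbabilityMeasure Ω}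

/-- The density is `1 - m + r` with `r = dρ_c/dν`; by `apply_one_sub_add_le` the costs of removing
and of adding mass separate. -/
theorem phiDiv_mixture_le (hφ : ConvexOn ℝ≥0 Set.univ φ) (h1 : φ 1 = 0) {ρ : Measure Ω}
    [IsFiniteMeasure ρ] {m : ℝ} (h0 : 0 ≤ m) (hm : m ≤ 1) {μ : ProbabilityMeasure Ω}
    (hμ : (μ : Measure Ω) = (1 - m).toNNReal • (ν : Measure Ω) + ρ) :
    phiDiv φ μ ν ≤ φ (1 - m) +
      (∫⁻ ω, φ (1 + (ρ.rnDeriv (ν : Measure Ω) ω).toReal) ∂(ν : Measure Ω) +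
        ρ.singularPart (ν : Measure Ω) Set.univ * slopeAtTop φ) := by
  have hs : (μ : Measure Ω).singularPart (ν : Measure Ω) = ρ.singularPart (ν : Measure Ω) := by
    rw [hμ, Measure.singularPart_add, Measure.singularPart_smul, Measure.singularPart_self,
      smul_zero, zero_add]
  have hr : (μ : Measure Ω).rnDeriv (ν : Measure Ω) =ᵐ[(ν : Measure Ω)]
      fun ω => ENNReal.ofReal (1 - m) + ρ.rnDeriv (ν : Measure Ω) ω := by
    rw [hμ]
    filter_upwards [Measure.rnDeriv_add ((1 - m).toNNReal • (ν : Measure Ω)) ρ (ν : Measure Ω),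
      Measure.rnDeriv_smul_left (ν : Measure Ω) (ν : Measure Ω) (1 - m).toNNReal,
      Measure.rnDeriv_self (ν : Measure Ω)] with ω e1 e2 e3
    rw [e1, Pi.add_apply, e2, Pi.smul_apply, e3, ENNReal.smul_def, smul_eq_mul, mul_one]
    rfl
  have hmeas := (ρ.measurable_rnDeriv (ν : Measure Ω)).ennreal_toReal
  rw [phiDiv, hs, ← add_assoc]
  gcongr
  have hconst : φ (1 - m) = ∫⁻ _, φ (1 - m) ∂(ν : Measure Ω) := by simp
  rw [hconst, ← lintegral_add_left measurable_const]
  refine lintegral_mono_ae ?_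
  filter_upwards [hr, ρ.rnDeriv_lt_top (ν : Measure Ω)] with ω hω hω'
  rw [hω, ENNReal.toReal_add ENNReal.ofReal_ne_top hω'.ne,
    ENNReal.toReal_ofReal (sub_nonneg.2 hm)]
  exact apply_one_sub_add_le hφ h1 h0 ENNReal.toReal_nonneg

/-- Adding to `ν` small masses that are cheap for `φ` and carry a fixed amount of `g` yields a
sequence along which the integrals of `g` do not converge, although the divergences do. -/
theorem exists_not_tendsto (hφ : ConvexOn ℝ≥0 Set.univ φ) (h1 : φ 1 = 0)
    (hdom : (1 : ℝ) ∈ interior {x : ℝ | φ x < ∞}) (hg : Measurable g) {S : SigmaIdeal Ω}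
    (hν : ν ∈ integratingProbs S g) {C : ℝ≥0∞} (hC : C ≠ ∞)
    (H : ∀ n : ℕ, ∃ ρ : Measure Ω, (∀ B ∈ S.sets, ρ B = 0) ∧
      ρ Set.univ ≤ ENNReal.ofReal (1 / ((n : ℝ) + 1)) ∧ (∀ᵐ ω ∂ρ, 0 ≤ g ω) ∧
      1 ≤ ∫⁻ ω, ENNReal.ofReal (g ω) ∂ρ ∧ ∫⁻ ω, ENNReal.ofReal (g ω) ∂ρ < ∞ ∧
      ∫⁻ ω, φ (1 + (ρ.rnDeriv (ν : Measure Ω) ω).toReal) ∂(ν : Measure Ω) +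
        ρ.singularPart (ν : Measure Ω) Set.univ * slopeAtTop φ ≤
          C * ENNReal.ofReal (1 / ((n : ℝ) + 1))) :
    ∃ νs : ℕ → ProbabilityMeasure Ω, (∀ n, νs n ∈ integratingProbs S g) ∧
      Tendsto (fun n => phiDiv φ (νs n) ν) atTop (𝓝 0) ∧
      ¬ Tendsto (fun n => ∫ ω, g ω ∂(νs n : Measure Ω)) atTop
        (𝓝 (∫ ω, g ω ∂(ν : Measure Ω))) := by
  choose ρ hS hmass hpos hge hlt hcost using H
  have hfin : ∀ n, IsFiniteMeasure (ρ n) := fun n => ⟨(hmass n).trans_lt ENNReal.ofReal_lt_top⟩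
  set m : ℕ → ℝ := fun n => ((ρ n) Set.univ).toReal with hm
  have hm0 : ∀ n, 0 ≤ m n := fun n => ENNReal.toReal_nonneg
  have hmn : ∀ n, m n ≤ 1 / ((n : ℝ) + 1) := fun n =>
    ENNReal.toReal_le_of_le_ofReal (by positivity) (hmass n)
  have hm1 : ∀ n, m n ≤ 1 := fun n => (hmn n).trans (by
    rw [div_le_one (by positivity)]; linarith [(Nat.cast_nonneg n : (0 : ℝ) ≤ n)])
  have hone : Tendsto (fun n : ℕ => 1 / ((n : ℝ) + 1)) atTop (𝓝 0) :=
    tendsto_one_div_add_atTop_nhds_zero_nat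
  have hmlim : Tendsto m atTop (𝓝 0) := squeeze_zero hm0 hmn hone
  have hρu : ∀ n, (ρ n) Set.univ = ENNReal.ofReal (m n) := fun n =>
    (ENNReal.ofReal_toReal (measure_ne_top _ _)).symm
  have hprob : ∀ n, IsProbabilityMeasure ((1 - m n).toNNReal • (ν : Measure Ω) + ρ n) := by
    refine fun n => ⟨?_⟩
    rw [Measure.add_apply, Measure.smul_apply, hρu, measure_univ, ENNReal.smul_def, smul_eq_mul,
      mul_one, ← ENNReal.ofReal, ← ENNReal.ofReal_add (sub_nonneg.2 (hm1 n)) (hm0 n),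
      sub_add_cancel, ENNReal.ofReal_one]
  have habs : ∀ n, ∫⁻ ω, ‖g ω‖ₑ ∂(ρ n) = ∫⁻ ω, ENNReal.ofReal (g ω) ∂(ρ n) := fun n => by
    refine lintegral_congr_ae ?_
    filter_upwards [hpos n] with ω hω
    rw [Real.enorm_eq_ofReal hω]
  have hint : ∀ n, Integrable g (ρ n) := fun n =>
    ⟨hg.aestronglyMeasurable, by rw [HasFiniteIntegral, habs]; exact hlt n⟩
  refine ⟨fun n => ⟨_, hprob n⟩, fun n => mem_integratingProbs_iff.2 ⟨fun B hB => ?_, ?_⟩, ?_, ?_⟩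
  · have := (mem_integratingProbs_iff.1 hν).1 B hB
    simp [Measure.add_apply, hS n B hB, this]
  · have := (mem_integratingProbs_iff.1 hν).2
    simp only [ProbabilityMeasure.coe_mk, lintegral_add_measure, lintegral_smul_measure, habs,
      ENNReal.smul_def, smul_eq_mul]
    exact ENNReal.add_lt_top.2 ⟨ENNReal.mul_lt_top (by simp) this, hlt n⟩
  · have hlim : Tendsto (fun n => φ (1 - m n) + C * ENNReal.ofReal (1 / ((n : ℝ) + 1))) atTop
        (𝓝 0) := by
      have h2 := ENNReal.Tendsto.const_mul (a := C) (ENNReal.tendsto_ofReal hone) (Or.inr hC)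
      simpa using (tendsto_apply_one_sub hφ h1 hdom hm0 hmlim).add h2
    refine tendsto_of_tendsto_of_tendsto_of_le_of_le tendsto_const_nhds hlim
      (fun _ => zero_le) fun n => ?_
    exact (phiDiv_mixture_le hφ h1 (hm0 n) (hm1 n) rfl).trans (by gcongr; exact hcost n)
  · intro hT
    have hi := integrable_of_mem hg hν
    have e : ∀ n, ∫ ω, g ω ∂((1 - m n).toNNReal • (ν : Measure Ω) + ρ n) =
        (1 - m n) * ∫ ω, g ω ∂(ν : Measure Ω) + ∫ ω, g ω ∂(ρ n) := fun n => by
      rw [integral_add_measure (hi.smul_measure_nnreal) (hint n), integral_smul_nnreal_measure,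
        NNReal.smul_def, Real.coe_toNNReal _ (sub_nonneg.2 (hm1 n)), smul_eq_mul]
    simp only [ProbabilityMeasure.coe_mk, e] at hT
    -- Subtracting the share of `ν` would give `∫ g dρ n → 0`, whereas these integrals are at least
    -- `1`.
    have h3 := hT.sub ((tendsto_const_nhds (x := (1 : ℝ)).sub hmlim).mul_const
      (∫ ω, g ω ∂(ν : Measure Ω)))
    simp only [add_sub_cancel_left, sub_zero, one_mul, sub_self] at h3
    have h4 : (1 : ℝ) ≤ 0 := by
      refine ge_of_tendsto' h3 fun n => ?_
      rw [integral_eq_lintegral_of_nonneg_ae (hpos n) hg.aestronglyMeasurable]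
      rw [← ENNReal.toReal_one]
      exact ENNReal.toReal_mono (hlt n).ne (hge n)
    norm_num at h4

end Mixture

/-! ### Counterexamples when `φ'(∞) < ∞` -/

section FiniteSlope

variable {φ : ℝ → ℝ≥0∞} {g : Ω → ℝ} {ν : ProbabilityMeasure Ω}

/-- Added mass costs at most `φ'(∞)` per unit, whether it is absolutely continuous or singular. -/
theorem perturbation_cost_le (hφ : ConvexOn ℝ≥0 Set.univ φ) (h1 : φ 1 = 0) (ρ : Measure Ω)
    [IsFiniteMeasure ρ] :
    ∫⁻ ω, φ (1 + (ρ.rnDeriv (ν : Measure Ω) ω).toReal) ∂(ν : Measure Ω) +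
      ρ.singularPart (ν : Measure Ω) Set.univ * slopeAtTop φ ≤ slopeAtTop φ * ρ Set.univ := by
  have h := lintegral_eq_singularPart_add ρ (ν : Measure Ω) (F := fun _ => slopeAtTop φ)
    measurable_const
  simp only [lintegral_const] at h
  rw [h, add_comm]
  refine add_le_add (mul_comm _ _).le (lintegral_mono fun ω => ?_)
  exact apply_one_add_le_slope hφ h1 ENNReal.toReal_nonneg

/-- Since `{g > n + 1}` is not in `Ξ`, it carries a probability measure integrating `g`; the
fraction `1 / (n + 1)` of it still has `g`-integral at least `1`. -/
theorem exists_not_tendsto_of_slope_lt_top (hφ : ConvexOn ℝ≥0 Set.univ φ)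
    (h1 : φ 1 = 0) (hdom : (1 : ℝ) ∈ interior {x : ℝ | φ x < ∞}) (hg : Measurable g)
    {S : SigmaIdeal Ω} (hν : ν ∈ integratingProbs S g) (hc : slopeAtTop φ < ∞)
    (H : ∀ M : ℝ, {ω | M < g ω} ∉ (commonNullIdeal (integratingMeasures S g)).sets) :
    ∃ νs : ℕ → ProbabilityMeasure Ω, (∀ n, νs n ∈ integratingProbs S g) ∧
      Tendsto (fun n => phiDiv φ (νs n) ν) atTop (𝓝 0) ∧
      ¬ Tendsto (fun n => ∫ ω, g ω ∂(νs n : Measure Ω)) atTop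
        (𝓝 (∫ ω, g ω ∂(ν : Measure Ω))) := by
  refine exists_not_tendsto hφ h1 hdom hg hν hc.ne fun n => ?_
  have hn : (0 : ℝ) < n + 1 := by positivity
  obtain ⟨p, hp, hpS, hpg, hpA⟩ := exists_probabilityMeasure_of_notMem
    (measurableSet_lt measurable_const hg) (H (n + 1))
  have hae : ∀ᵐ ω ∂p, (n : ℝ) + 1 < g ω := hpA
  set r := ENNReal.ofReal (1 / ((n : ℝ) + 1)) with hr
  have hu : (r • p) Set.univ = r := by simp
  have hrf : IsFiniteMeasure (r • p) := ⟨by rw [hu]; exact ENNReal.ofReal_lt_top⟩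
  refine ⟨r • p, fun B hB => by simp [hpS B hB], hu.le, ?_, ?_, ?_, ?_⟩
  · exact Measure.ae_smul_measure (hae.mono fun ω hω => hn.le.trans hω.le) r
  · rw [lintegral_smul_measure, smul_eq_mul]
    have h2 : ENNReal.ofReal (n + 1) ≤ ∫⁻ ω, ENNReal.ofReal (g ω) ∂p := by
      calc _ = ∫⁻ _, ENNReal.ofReal (n + 1) ∂p := by simp
        _ ≤ _ := lintegral_mono_ae (hae.mono fun ω hω => ENNReal.ofReal_le_ofReal hω.le)
    calc 1 = r * ENNReal.ofReal (n + 1) := by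
          rw [hr, ← ENNReal.ofReal_mul (by positivity), one_div_mul_cancel hn.ne',
            ENNReal.ofReal_one]
      _ ≤ _ := by gcongr
  · rw [lintegral_smul_measure, smul_eq_mul]
    refine ENNReal.mul_lt_top ENNReal.ofReal_lt_top
      (lt_of_le_of_lt (lintegral_mono fun ω => ?_) hpg)
    exact Real.ofReal_le_enorm _
  · exact (perturbation_cost_le hφ h1 _).trans (by rw [hu])

end FiniteSlope

/-! ### Counterexamples when `φ'(∞) = ∞` -/

section InfiniteSlope

variable {φ : ℝ → ℝ≥0∞} {g : Ω → ℝ} {ν : ProbabilityMeasure Ω}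

/-- The largest `x ≥ 0` with `φ (1 + x) ≤ s x`. -/
def breakEven (φ : ℝ → ℝ≥0∞) (s : ℝ) : ℝ :=
  sSup {x : ℝ | 0 ≤ x ∧ φ (1 + x) ≤ ENNReal.ofReal (s * x)}

theorem bddAbove_breakEven (hφ : ConvexOn ℝ≥0 Set.univ φ) (h1 : φ 1 = 0)
    (hc : slopeAtTop φ = ∞) (s : ℝ) :
    BddAbove {x : ℝ | 0 ≤ x ∧ φ (1 + x) ≤ ENNReal.ofReal (s * x)} := by
  obtain ⟨z, hz, h⟩ := exists_mul_le_of_slope_eq_top hφ h1 hc (|s| + 1)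
  refine ⟨z, fun x hx => ?_⟩
  by_contra! hlt
  have hx0 : 0 < x := hz.trans hlt
  have h2 := (h x hlt.le).trans hx.2
  have h3 : 0 < (|s| + 1) * x := by positivity
  have h4 : s * x ≤ |s| * x := mul_le_mul_of_nonneg_right (le_abs_self s) hx0.le
  have h5 := (ENNReal.ofReal_le_ofReal_iff' ).1 h2
  rcases h5 with h5 | h5 <;> linarith

theorem zero_mem_breakEven (h1 : φ 1 = 0) (s : ℝ) :
    (0 : ℝ) ∈ {x : ℝ | 0 ≤ x ∧ φ (1 + x) ≤ ENNReal.ofReal (s * x)} := by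
  simp [h1]

theorem breakEven_nonneg (hφ : ConvexOn ℝ≥0 Set.univ φ) (h1 : φ 1 = 0)
    (hc : slopeAtTop φ = ∞) (s : ℝ) : 0 ≤ breakEven φ s :=
  le_csSup (bddAbove_breakEven hφ h1 hc s) (zero_mem_breakEven h1 s)

theorem monotone_breakEven (hφ : ConvexOn ℝ≥0 Set.univ φ) (h1 : φ 1 = 0)
    (hc : slopeAtTop φ = ∞) : Monotone (breakEven φ) := fun s s' hs =>
  csSup_le_csSup (bddAbove_breakEven hφ h1 hc s') ⟨0, zero_mem_breakEven h1 s⟩ fun _ hx =>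
    ⟨hx.1, hx.2.trans (ENNReal.ofReal_le_ofReal (mul_le_mul_of_nonneg_right hs hx.1))⟩

/-- The supremum is attained: lower semicontinuity makes the set closed. -/
theorem apply_breakEven_le (hφ : ConvexOn ℝ≥0 Set.univ φ) (hlsc : LowerSemicontinuous φ)
    (h1 : φ 1 = 0) (hc : slopeAtTop φ = ∞) (s : ℝ) :
    φ (1 + breakEven φ s) ≤ ENNReal.ofReal (s * breakEven φ s) := by
  have hcl : IsClosed {x : ℝ | 0 ≤ x ∧ φ (1 + x) ≤ ENNReal.ofReal (s * x)} := by
    refine (isClosed_le continuous_const continuous_id).inter ?_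
    have h2 : LowerSemicontinuous fun x : ℝ => φ (1 + x) := hlsc.comp (by fun_prop)
    have h3 : Continuous fun x : ℝ => ENNReal.ofReal (s * x) :=
      ENNReal.continuous_ofReal.comp (by fun_prop)
    exact (h2.isClosed_epigraph).preimage (continuous_id.prodMk h3)
  exact (hcl.csSup_mem ⟨0, zero_mem_breakEven h1 s⟩ (bddAbove_breakEven hφ h1 hc s)).2

/-- Beyond the break-even point `y s - φ (1 + y)` is not positive; before it, `y s` alone is at most
`s * breakEven φ s`. -/
theorem psiStar_le_breakEven (hφ : ConvexOn ℝ≥0 Set.univ φ) (h1 : φ 1 = 0)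
    (hc : slopeAtTop φ = ∞) {s : ℝ} (hs : 0 ≤ s) :
    psiStar φ s ≤ ENNReal.ofReal (s * breakEven φ s) := by
  refine psiStar_le_iff.2 fun y => ?_
  rcases lt_or_ge y 0 with hy | hy
  · rw [ENNReal.ofReal_of_nonpos (by nlinarith)]
    exact zero_le
  rw [add_comm y 1, mul_comm y s]
  rcases le_total (φ (1 + y)) (ENNReal.ofReal (s * y)) with h | h
  · refine le_add_left (ENNReal.ofReal_le_ofReal (mul_le_mul_of_nonneg_left ?_ hs))
    exact le_csSup (bddAbove_breakEven hφ h1 hc s) ⟨hy, h⟩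
  · exact le_add_right h

/-- Where `g ≤ 0`, the bound `-t g` is integrable; where `0 ≤ g ≤ M`, `ψ*(t M)` dominates. A
divergent integral must therefore come from large `g`. -/
theorem setLIntegral_psiStar_lt_top (hneg : ∀ x : ℝ, x < 0 → φ x = ∞)
    (hφ : ConvexOn ℝ≥0 Set.univ φ) (h1 : φ 1 = 0) (hc : slopeAtTop φ = ∞) (hg : Measurable g)
    (hν : Integrable g (ν : Measure Ω)) {t : ℝ} (ht : 0 < t) {M : ℝ} (hM : 0 < M) :
    ∫⁻ ω in {ω | g ω ≤ M}, psiStar φ (t * g ω) ∂(ν : Measure Ω) < ∞ := by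
  have hfin : ∫⁻ ω, (ENNReal.ofReal (-(t * g ω)) + psiStar φ (t * M)) ∂(ν : Measure Ω) < ∞ := by
    rw [lintegral_add_left (by fun_prop)]
    refine ENNReal.add_lt_top.2 ⟨(hν.const_mul t).neg.lintegral_lt_top, ?_⟩
    simpa using psiStar_lt_top hφ h1 hneg hc _
  refine lt_of_le_of_lt (setLIntegral_mono (by fun_prop) fun ω hω => ?_)
    ((setLIntegral_le_lintegral _ _).trans_lt hfin)
  rcases le_total (g ω) 0 with h | h
  · exact le_add_right (psiStar_le_neg hneg (by nlinarith))
  · refine le_add_left ?_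
    have hle : g ω / M ≤ 1 := (div_le_one hM).2 hω
    have := psiStar_mul_le (φ := φ) (by positivity) hle (t * M)
    rw [show g ω / M * (t * M) = t * g ω by field_simp] at this
    exact this.trans (mul_le_of_le_one_left zero_le (by simpa using hle))

theorem exists_not_tendsto_of_slope_eq_top (hφ : ConvexOn ℝ≥0 Set.univ φ)
    (hlsc : LowerSemicontinuous φ) (h1 : φ 1 = 0) (hneg : ∀ x : ℝ, x < 0 → φ x = ∞)
    (hdom : (1 : ℝ) ∈ interior {x : ℝ | φ x < ∞}) (hg : Measurable g)
    {S : SigmaIdeal Ω} (hν : ν ∈ integratingProbs S g) (hc : slopeAtTop φ = ∞)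
    (H : ∀ t : ℝ, 0 < t → ∫⁻ ω, psiStar φ (t * g ω) ∂(ν : Measure Ω) = ∞) :
    ∃ νs : ℕ → ProbabilityMeasure Ω, (∀ n, νs n ∈ integratingProbs S g) ∧
      Tendsto (fun n => phiDiv φ (νs n) ν) atTop (𝓝 0) ∧
      ¬ Tendsto (fun n => ∫ ω, g ω ∂(νs n : Measure Ω)) atTop
        (𝓝 (∫ ω, g ω ∂(ν : Measure Ω))) := by
  refine exists_not_tendsto hφ h1 hdom hg hν ENNReal.one_ne_top fun n => ?_
  have hM : (0 : ℝ) < n + 1 := by positivity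
  set t : ℝ := 1 / ((n : ℝ) + 1) with ht'
  have ht : 0 < t := by positivity
  have hmono := monotone_breakEven hφ h1 hc
  have hbm : Measurable (breakEven φ) := hmono.measurable
  have hb0 := breakEven_nonneg hφ h1 hc
  set F : Ω → ℝ≥0∞ := fun ω => ENNReal.ofReal (t * g ω * breakEven φ (t * g ω)) with hF
  have hFm : Measurable F := by fun_prop
  have hInf : ∫⁻ ω in {ω | (n : ℝ) + 1 < g ω}, F ω ∂(ν : Measure Ω) = ∞ := by
    have hms : MeasurableSet {ω | g ω ≤ (n : ℝ) + 1} := measurableSet_le hg measurable_const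
    have h2 := lintegral_add_compl (μ := (ν : Measure Ω)) (fun ω => psiStar φ (t * g ω)) hms
    rw [H t ht, ENNReal.add_eq_top] at h2
    have h3 := h2.resolve_left
      (setLIntegral_psiStar_lt_top hneg hφ h1 hc hg (integrable_of_mem hg hν) ht hM).ne
    have hcompl : {ω | g ω ≤ (n : ℝ) + 1}ᶜ = {ω | (n : ℝ) + 1 < g ω} := by ext; simp
    rw [hcompl] at h3
    rw [← top_le_iff, ← h3]
    refine setLIntegral_mono hFm fun ω hω => psiStar_le_breakEven hφ h1 hc ?_
    have : (n : ℝ) + 1 < g ω := hω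
    exact mul_nonneg ht.le (by linarith)
  -- Truncation at `N` keeps the gain `E` finite, yet above `t`, so that `θ = t / E ≤ 1` is a
  -- legitimate convexity weight.
  obtain ⟨N, hN⟩ : ∃ N : ℕ, ENNReal.ofReal t <
      ∫⁻ ω in {ω | (n : ℝ) + 1 < g ω ∧ g ω ≤ N}, F ω ∂(ν : Measure Ω) := by
    have hU : {ω | (n : ℝ) + 1 < g ω} = ⋃ N : ℕ, {ω | (n : ℝ) + 1 < g ω ∧ g ω ≤ N} := by
      ext ω
      simpa using fun _ => exists_nat_ge (g ω)
    have hdir : Directed (· ⊆ ·) fun N : ℕ => {ω | (n : ℝ) + 1 < g ω ∧ g ω ≤ N} :=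
      (monotone_nat_of_le_succ fun N ω hω =>
        ⟨hω.1, hω.2.trans (by exact_mod_cast Nat.le_succ N)⟩).directed_le
    rw [hU, setLIntegral_iUnion_of_directed _ hdir] at hInf
    exact lt_iSup_iff.1 (hInf ▸ ENNReal.ofReal_lt_top)
  set A : Set Ω := {ω | (n : ℝ) + 1 < g ω ∧ g ω ≤ N} with hA
  have hAm : MeasurableSet A :=
    (measurableSet_lt measurable_const hg).inter (measurableSet_le hg measurable_const)
  have hAg : ∀ ω ∈ A, 0 < g ω := fun ω hω => hM.trans hω.1
  have hEtop : ∫⁻ ω in A, F ω ∂(ν : Measure Ω) ≠ ∞ := by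
    refine ((setLIntegral_mono' (g := fun _ => ENNReal.ofReal (t * N * breakEven φ (t * N))) hAm
      fun ω hω => ENNReal.ofReal_le_ofReal ?_).trans_lt ?_).ne
    · have h2 : t * g ω ≤ t * N := mul_le_mul_of_nonneg_left hω.2 ht.le
      have h3 : 0 ≤ t * g ω := mul_nonneg ht.le (hAg ω hω).le
      exact mul_le_mul h2 (hmono h2) (hb0 _) (h3.trans h2)
    · rw [setLIntegral_const]
      exact ENNReal.mul_lt_top ENNReal.ofReal_lt_top (measure_lt_top _ _)
  set E : ℝ := (∫⁻ ω in A, F ω ∂(ν : Measure Ω)).toReal with hE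
  have hEof : ∫⁻ ω in A, F ω ∂(ν : Measure Ω) = ENNReal.ofReal E :=
    (ENNReal.ofReal_toReal hEtop).symm
  have htE : t < E := by
    rw [hEof] at hN
    exact (ENNReal.ofReal_lt_ofReal_iff_of_nonneg ht.le).1 hN
  have hE0 : 0 < E := ht.trans htE
  -- This normalisation gives `∫ g dρ = θ E / t = 1` and cost at most `θ E = t = 1 / (n + 1)`.
  set θ : ℝ := t / E with hθ
  have hθ0 : 0 < θ := by positivity
  have hθ1 : θ ≤ 1 := (div_le_one hE0).2 htE.le
  set d : Ω → ℝ≥0∞ := A.indicator fun ω => ENNReal.ofReal (θ * breakEven φ (t * g ω)) with hd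
  have hdm : Measurable d := Measurable.indicator (by fun_prop) hAm
  set ρ : Measure Ω := (ν : Measure Ω).withDensity d with hρ
  have hsing : ρ.singularPart (ν : Measure Ω) = 0 :=
    Measure.singularPart_withDensity _ _
  have haeA : ∀ᵐ ω ∂ρ, ω ∈ A := by
    rw [hρ, ae_withDensity_iff hdm]
    refine Eventually.of_forall fun ω hω => ?_
    by_contra hcon
    exact hω (Set.indicator_of_notMem hcon _)
  have hgint : ∫⁻ ω, ENNReal.ofReal (g ω) ∂ρ = 1 := by
    rw [hρ, lintegral_withDensity_eq_lintegral_mul _ hdm (by fun_prop)]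
    have h2 : ∀ ω, (d * fun ω => ENNReal.ofReal (g ω)) ω =
        A.indicator (fun ω => ENNReal.ofReal E⁻¹ * F ω) ω := by
      intro ω
      by_cases hω : ω ∈ A
      · simp only [Pi.mul_apply, hd, Set.indicator_of_mem hω, hF]
        rw [← ENNReal.ofReal_mul (mul_nonneg hθ0.le (hb0 _)),
          ← ENNReal.ofReal_mul (by positivity), hθ]
        congr 1
        ring
      · simp [hd, hω]
    rw [lintegral_congr h2, lintegral_indicator hAm, lintegral_const_mul _ hFm, hEof,
      ← ENNReal.ofReal_mul (by positivity), inv_mul_cancel₀ hE0.ne', ENNReal.ofReal_one]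
  refine ⟨ρ, fun B hB => withDensity_absolutelyContinuous _ _
    ((mem_integratingProbs_iff.1 hν).1 B hB), ?_, haeA.mono fun ω hω => (hAg ω hω).le, hgint.ge,
    hgint ▸ ENNReal.one_lt_top, ?_⟩
  · have h2 : ENNReal.ofReal (n + 1) * ρ Set.univ ≤ 1 := by
      rw [← hgint, ← lintegral_const]
      exact lintegral_mono_ae (haeA.mono fun ω hω => ENNReal.ofReal_le_ofReal hω.1.le)
    calc ρ Set.univ = ENNReal.ofReal t * (ENNReal.ofReal (n + 1) * ρ Set.univ) := by
          rw [← mul_assoc, ← ENNReal.ofReal_mul ht.le, ht', one_div_mul_cancel hM.ne',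
            ENNReal.ofReal_one, one_mul]
      _ ≤ ENNReal.ofReal t * 1 := by gcongr
      _ = _ := mul_one _
  · rw [hsing, Measure.coe_zero, Pi.zero_apply, zero_mul, add_zero, one_mul]
    calc ∫⁻ ω, φ (1 + (ρ.rnDeriv (ν : Measure Ω) ω).toReal) ∂(ν : Measure Ω)
        ≤ ∫⁻ ω, A.indicator (fun ω => ENNReal.ofReal θ * F ω) ω ∂(ν : Measure Ω) := by
          refine lintegral_mono_ae ?_
          filter_upwards [Measure.rnDeriv_withDensity (ν : Measure Ω) hdm] with ω hω
          rw [hω]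
          by_cases hωA : ω ∈ A
          · simp only [hd, Set.indicator_of_mem hωA]
            rw [ENNReal.toReal_ofReal (mul_nonneg hθ0.le (hb0 _))]
            exact (apply_one_add_mul_le hφ h1 hθ0.le hθ1 _).trans
              (by gcongr; exact apply_breakEven_le hφ hlsc h1 hc _)
          · simp [hd, hωA, h1]
      _ = ENNReal.ofReal t := by
          rw [lintegral_indicator hAm, lintegral_const_mul _ hFm, hEof,
            ← ENNReal.ofReal_mul hθ0.le, hθ, div_mul_cancel₀ _ hE0.ne']

end InfiniteSlope

/-! ### `K(t) = o(t)` under condition 6 -/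

section Small

variable {φ : ℝ → ℝ≥0∞} {g : Ω → ℝ} {ν : ProbabilityMeasure Ω} {Ξ : SigmaIdeal Ω}

theorem exists_cgf_le_of_essBounded (hφ : ConvexOn ℝ≥0 Set.univ φ) (h1 : φ 1 = 0)
    (hzero : (1 : ℝ) ∉ interior {x : ℝ | φ x = 0}) (hc : slopeAtTop φ < ∞) (hg : Measurable g)
    (hν : ν ∈ acProb Ξ) (hb : EssBounded Ξ g) {ε : ℝ} (hε : 0 < ε) :
    ∃ t : ℝ, 0 < t ∧ cgf φ g ν Ξ t ≤ ENNReal.ofReal (ε * t) := by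
  obtain ⟨M, hM, hMΞ⟩ := (essBounded_iff hg).1 hb
  obtain ⟨σ, hσ, hpos⟩ := exists_sign_pos hφ h1 hzero
  obtain ⟨δ, hδ, hδ'⟩ := exists_psiStar_le hφ h1 hσ hpos (ε := ε / (2 * M)) (by positivity)
  have hσ2 : σ * σ = 1 := by rcases hσ with rfl | rfl <;> norm_num
  have hrange : ∀ x : ℝ, |x| ≤ M → 0 ≤ σ * x + M ∧ σ * x + M ≤ 2 * M := fun x hx => by
    have := abs_le.1 hx
    rcases hσ with rfl | rfl <;> constructor <;> linarith
  -- `κ` makes the shift `σ t M` admissible. For `σ = 1`, `φ'(∞) ≥ φ 2 > 0` leaves room for small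
  -- `t`; for `σ = -1`, the shifted function is nonpositive where `|g| ≤ M`.
  obtain ⟨κ, hκ, hκ'⟩ : ∃ κ : ℝ, 0 < κ ∧ ∀ t : ℝ, 0 < t → t * (2 * M) ≤ κ → ∀ x : ℝ, |x| ≤ M →
      ENNReal.ofReal (t * x + σ * t * M) ≤ slopeAtTop φ := by
    rcases hσ with rfl | rfl
    · have h2 := apply_one_add_le_slope hφ h1 zero_le_one
      have h3 := hpos 1 one_pos
      rw [one_mul] at h3
      rw [ENNReal.ofReal_one, one_mul] at h2
      refine ⟨(slopeAtTop φ).toReal, ENNReal.toReal_pos (h3.trans_le h2).ne' hc.ne,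
        fun t ht htκ x hx => ENNReal.ofReal_le_of_le_toReal (le_trans ?_ htκ)⟩
      have := mul_le_mul_of_nonneg_left (hrange x hx).2 ht.le
      linarith
    · refine ⟨1, one_pos, fun t ht _ x hx => ?_⟩
      rw [ENNReal.ofReal_of_nonpos]
      · exact zero_le
      · have := mul_nonneg ht.le (hrange x hx).1
        linarith
  set t := min δ κ / (2 * M) with ht'
  have ht : 0 < t := by positivity
  have htM : t * (2 * M) = min δ κ := div_mul_cancel₀ _ (by positivity)
  have hbν : ∀ᵐ ω ∂(ν : Measure Ω), |g ω| ≤ M := by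
    rw [ae_iff]
    simpa using hν _ hMΞ
  refine ⟨t, ht, (cgf_le hg (l := σ * t * M) (Ξ.subset_mem _ _ ?_ ?_ hMΞ)).trans ?_⟩
  · exact measurableSet_lt measurable_const (by fun_prop)
  · intro ω hω
    rw [Set.mem_ofPred_eq] at hω ⊢
    contrapose! hω
    exact hκ' t ht (htM.trans_le (min_le_right _ _)) _ hω
  · calc _ ≤ ∫⁻ _, ENNReal.ofReal (ε * t) ∂(ν : Measure Ω) := by
          refine lintegral_mono_ae (hbν.mono fun ω hω => ?_)
          obtain ⟨h2, h3⟩ := hrange _ hω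
          have h4 : t * (σ * g ω + M) ≤ t * (2 * M) := by gcongr
          have h5 : t * g ω + σ * t * M = σ * (t * (σ * g ω + M)) := by
            linear_combination (-(t * g ω)) * hσ2
          rw [h5]
          refine (hδ' _ (by positivity) (h4.trans (htM.trans_le (min_le_left _ _)))).trans
            (ENNReal.ofReal_le_ofReal ?_)
          calc _ ≤ ε / (2 * M) * (t * (2 * M)) := by gcongr
            _ = ε * t := by field_simp
      _ = _ := by simp

/-- Difference quotients of `ψ*` at `0` decrease with `t`, as monotone convergence will require. -/
theorem inv_mul_psiStar_le {t t' : ℝ} (ht' : 0 < t') (h : t' ≤ t) (x : ℝ) :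
    ENNReal.ofReal t'⁻¹ * psiStar φ (t' * x) ≤ ENNReal.ofReal t⁻¹ * psiStar φ (t * x) := by
  have ht := ht'.trans_le h
  have h2 := psiStar_mul_le (φ := φ) (θ := t' / t) (by positivity) ((div_le_one ht).2 h) (t * x)
  rw [show t' / t * (t * x) = t' * x by field_simp] at h2
  calc _ ≤ ENNReal.ofReal t'⁻¹ * (ENNReal.ofReal (t' / t) * psiStar φ (t * x)) := by gcongr
    _ = _ := by
      rw [← mul_assoc, ← ENNReal.ofReal_mul (by positivity)]
      congr 2
      field_simp

/-- The directional derivative of `ψ*` at `0`. -/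
theorem iInf_inv_mul_psiStar_le (hφ : ConvexOn ℝ≥0 Set.univ φ) (h1 : φ 1 = 0) {σ : ℝ}
    (hσ : σ = 1 ∨ σ = -1) (hpos : ∀ y : ℝ, 0 < y → 0 < φ (1 + σ * y)) {t : ℝ} (ht : 0 < t) (x : ℝ) :
    ⨅ n : ℕ, ENNReal.ofReal (t / ((n : ℝ) + 1))⁻¹ * psiStar φ (t / ((n : ℝ) + 1) * x) ≤
      psiStar φ (-σ) * ENNReal.ofReal (-(σ * x)) := by
  have hσ2 : σ * σ = 1 := by rcases hσ with rfl | rfl <;> norm_num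
  have hsmall : ∀ a b : ℝ, 0 < b → ∃ n : ℕ, t / ((n : ℝ) + 1) * a ≤ b := by
    intro a b hb
    obtain ⟨n, hn⟩ := exists_nat_ge (t * a / b)
    refine ⟨n, ?_⟩
    rw [div_le_iff₀ hb] at hn
    rw [div_mul_eq_mul_div, div_le_iff₀ (by positivity)]
    linarith
  rcases le_total 0 (σ * x) with h | h
  · refine le_trans ?_ zero_le
    refine le_of_forall_gt_imp_ge_of_dense fun η hη => ?_
    obtain ⟨e, he, he0, heη⟩ : ∃ e : ℝ, 0 ≤ e ∧ 0 < e ∧ ENNReal.ofReal e ≤ η := by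
      rcases eq_or_ne η ∞ with rfl | hη'
      · exact ⟨1, zero_le_one, one_pos, le_top⟩
      · exact ⟨η.toReal, ENNReal.toReal_nonneg, ENNReal.toReal_pos hη.ne' hη',
          ENNReal.ofReal_toReal_le⟩
    -- Adding `1` to `σ x` avoids division by zero and still gives the bound `e`.
    obtain ⟨δ, hδ, hδ'⟩ := exists_psiStar_le hφ h1 hσ hpos (ε := e / (σ * x + 1)) (by positivity)
    obtain ⟨n, hn⟩ := hsmall (σ * x) δ hδ
    have hs : 0 < t / ((n : ℝ) + 1) := by positivity
    refine (iInf_le _ n).trans (le_trans ?_ heη)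
    set s := t / ((n : ℝ) + 1)
    have h2 := hδ' _ (mul_nonneg hs.le h) hn
    rw [show σ * (s * (σ * x)) = s * x by linear_combination (s * x) * hσ2] at h2
    calc _ ≤ ENNReal.ofReal s⁻¹ * ENNReal.ofReal (e / (σ * x + 1) * (s * (σ * x))) := by gcongr
      _ = ENNReal.ofReal (e * ((σ * x) / (σ * x + 1))) := by
        rw [← ENNReal.ofReal_mul (by positivity)]
        congr 1
        field_simp
      _ ≤ _ := by
        refine ENNReal.ofReal_le_ofReal (mul_le_of_le_one_right he ?_)
        rw [div_le_one (by positivity)]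
        linarith
  · obtain ⟨n, hn⟩ := hsmall (-(σ * x)) 1 one_pos
    have hs : 0 < t / ((n : ℝ) + 1) := by positivity
    refine (iInf_le _ n).trans ?_
    set s := t / ((n : ℝ) + 1)
    have h2 := psiStar_mul_le (φ := φ) (mul_nonneg hs.le (neg_nonneg.2 h)) hn (-σ)
    rw [show s * -(σ * x) * -σ = s * x by linear_combination (s * x) * hσ2] at h2
    calc _ ≤ ENNReal.ofReal s⁻¹ * (ENNReal.ofReal (s * -(σ * x)) * psiStar φ (-σ)) := by gcongr
      _ = _ := by
        rw [← mul_assoc, ← ENNReal.ofReal_mul (by positivity), mul_comm]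
        congr 2
        field_simp

theorem exists_shift_lintegral_lt {L : ℝ≥0∞} (hL : L ≠ ∞) {f : Ω → ℝ} (hf : Measurable f)
    (hν : Integrable f (ν : Measure Ω)) {ε : ℝ≥0∞} (hε : 0 < ε) :
    ∃ M : ℕ, ∫⁻ ω, L * ENNReal.ofReal (-(f ω + M)) ∂(ν : Measure Ω) < ε := by
  have h := lintegral_iInf (μ := (ν : Measure Ω))
    (f := fun (M : ℕ) ω => L * ENNReal.ofReal (-(f ω + M))) (fun M => by fun_prop) (by
      intro M M' hMM ω
      have : (M : ℝ) ≤ M' := by exact_mod_cast hMM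
      change L * _ ≤ L * _
      gcongr) (by
      rw [lintegral_const_mul _ (by fun_prop)]
      have := hν.neg.lintegral_lt_top
      simp only [CharP.cast_eq_zero, add_zero]
      exact (ENNReal.mul_lt_top hL.lt_top this).ne)
  have h0 : ∀ ω, ⨅ M : ℕ, L * ENNReal.ofReal (-(f ω + M)) = 0 := fun ω => by
    obtain ⟨M, hM⟩ := exists_nat_ge (-f ω)
    refine le_antisymm ((iInf_le _ M).trans ?_) zero_le
    rw [ENNReal.ofReal_of_nonpos (by linarith), mul_zero]
  rw [lintegral_congr h0, lintegral_zero] at h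
  exact iInf_lt_iff.1 (h ▸ hε)

/-- The quotients `ψ*(s (g + σ M)) / s` decrease, as `s ↓ 0`, to at most `ψ*(-σ) (σ g + M)⁻`, whose
integral is below `ε` for large `M`. -/
theorem exists_cgf_le_of_slope_eq_top (hφ : ConvexOn ℝ≥0 Set.univ φ) (h1 : φ 1 = 0)
    (hneg : ∀ x : ℝ, x < 0 → φ x = ∞) (hzero : (1 : ℝ) ∉ interior {x : ℝ | φ x = 0})
    (hc : slopeAtTop φ = ∞) (hg : Measurable g) (hν : Integrable g (ν : Measure Ω))
    {t₀ : ℝ} (ht₀ : 0 < t₀) (hK : cgf φ g ν Ξ t₀ < ∞) {ε : ℝ} (hε : 0 < ε) :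
    ∃ t : ℝ, 0 < t ∧ cgf φ g ν Ξ t ≤ ENNReal.ofReal (ε * t) := by
  obtain ⟨l₀, -, hl₀⟩ := exists_of_cgf_lt hg hK
  obtain ⟨σ, hσ, hpos⟩ := exists_sign_pos hφ h1 hzero
  have hσ2 : σ * σ = 1 := by rcases hσ with rfl | rfl <;> norm_num
  obtain ⟨M, hM⟩ := exists_shift_lintegral_lt (psiStar_lt_top hφ h1 hneg hc (-σ)).ne
    (hg.const_mul σ) (hν.const_mul σ) (ENNReal.ofReal_pos.2 hε)
  set t₁ : ℝ := 2⁻¹ * t₀ with ht₁'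
  have ht₁ : 0 < t₁ := by positivity
  -- Halving `t₀` lets the midpoint inequality replace the given shift `l₀` by the desired `σ M`.
  have hfin : ∫⁻ ω, psiStar φ (t₁ * (g ω + σ * M)) ∂(ν : Measure Ω) < ∞ := by
    calc _ ≤ ∫⁻ ω, (psiStar φ (t₀ * g ω + l₀) + psiStar φ (t₀ * (σ * M) - l₀))
            ∂(ν : Measure Ω) := by
          refine lintegral_mono fun ω => ?_
          have := psiStar_half_add_le (φ := φ) (t₀ * g ω + l₀) (t₀ * (σ * M) - l₀)
          rwa [show 2⁻¹ * (t₀ * g ω + l₀) + 2⁻¹ * (t₀ * (σ * M) - l₀) = t₁ * (g ω + σ * M) by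
            rw [ht₁']; ring] at this
      _ < ∞ := by
          rw [lintegral_add_right _ measurable_const]
          refine ENNReal.add_lt_top.2 ⟨hl₀, ?_⟩
          simpa using psiStar_lt_top hφ h1 hneg hc _
  have h := lintegral_iInf (μ := (ν : Measure Ω))
    (f := fun (n : ℕ) ω => ENNReal.ofReal (t₁ / ((n : ℝ) + 1))⁻¹ *
      psiStar φ (t₁ / ((n : ℝ) + 1) * (g ω + σ * M))) (fun n => by fun_prop) (by
      intro n n' hnn ω
      have : (n : ℝ) ≤ n' := by exact_mod_cast hnn
      exact inv_mul_psiStar_le (by positivity) (by gcongr) _) (by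
      rw [lintegral_const_mul _ (by fun_prop)]
      simp only [CharP.cast_eq_zero, zero_add, div_one]
      exact (ENNReal.mul_lt_top ENNReal.ofReal_lt_top hfin).ne)
  have hlt : ∫⁻ ω, ⨅ n : ℕ, ENNReal.ofReal (t₁ / ((n : ℝ) + 1))⁻¹ *
      psiStar φ (t₁ / ((n : ℝ) + 1) * (g ω + σ * M)) ∂(ν : Measure Ω) < ENNReal.ofReal ε := by
    refine lt_of_le_of_lt (lintegral_mono fun ω => ?_) hM
    refine (iInf_inv_mul_psiStar_le hφ h1 hσ hpos ht₁ _).trans (le_of_eq ?_)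
    rw [show σ * (g ω + σ * M) = σ * g ω + M by linear_combination (M : ℝ) * hσ2]
  rw [h] at hlt
  obtain ⟨n, hn⟩ := iInf_lt_iff.1 hlt
  have hs : 0 < t₁ / ((n : ℝ) + 1) := by positivity
  set s := t₁ / ((n : ℝ) + 1)
  rw [lintegral_const_mul _ (by fun_prop)] at hn
  refine ⟨s, hs, (cgf_le hg (l := s * (σ * M)) ?_).trans ?_⟩
  · simp [hc, Ξ.empty_mem]
  · simp only [← mul_add]
    calc _ = ENNReal.ofReal s * (ENNReal.ofReal s⁻¹ *
            ∫⁻ ω, psiStar φ (s * (g ω + σ * M)) ∂(ν : Measure Ω)) := by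
          rw [← mul_assoc, ← ENNReal.ofReal_mul hs.le, mul_inv_cancel₀ hs.ne', ENNReal.ofReal_one,
            one_mul]
      _ ≤ ENNReal.ofReal s * ENNReal.ofReal ε := by gcongr
      _ = _ := by rw [← ENNReal.ofReal_mul hs.le, mul_comm]

end Small

/-! ### Differentiability and subgradients of `K` at `0` -/

section Subdifferential

variable {φ : ℝ → ℝ≥0∞} {g : Ω → ℝ} {ν : ProbabilityMeasure Ω} {Ξ : SigmaIdeal Ω}

theorem mem_subdifferential_cgf_iff (hg : Measurable g) {s : ℝ} :
    s ∈ subdifferential (fun t => (cgf φ g ν Ξ t : EReal)) 0 ↔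
      ∀ t : ℝ, ENNReal.ofReal (s * t) ≤ cgf φ g ν Ξ t := by
  simp only [subdifferential, Set.mem_ofPred_eq, cgf_zero hg, EReal.coe_ennreal_zero, zero_add,
    sub_zero]
  refine forall_congr' fun t => ?_
  rw [← EReal.coe_ennreal_le_coe_ennreal_iff, EReal.coe_ennreal_ofReal,
    EReal.coe_strictMono.monotone.map_max, max_le_iff]
  exact (and_iff_left (EReal.coe_ennreal_nonneg _)).symm

/-- For a subgradient `s`, `K(t) - s t` has a local minimum at `0`, so its derivative `-s` vanishes.
-/
theorem subdifferential_cgf_of_hasFiniteDerivAt (hg : Measurable g)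
    (h : HasFiniteDerivAt (cgf φ g ν Ξ) 0 0) :
    subdifferential (fun t => (cgf φ g ν Ξ t : EReal)) 0 = {0} := by
  ext s
  rw [mem_subdifferential_cgf_iff hg, Set.mem_singleton_iff]
  constructor
  · intro hs
    have hmin : IsLocalMin (fun t => (cgf φ g ν Ξ t).toReal - s * t) 0 := by
      filter_upwards [h.1] with t ht
      have h2 := (ENNReal.ofReal_le_iff_le_toReal ht.ne).1 (hs t)
      simp only [cgf_zero hg, ENNReal.toReal_zero, mul_zero, sub_zero]
      linarith
    have hd := hmin.hasDerivAt_eq_zero (h.2.sub ((hasDerivAt_id (0 : ℝ)).const_mul s))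
    simpa using hd
  · rintro rfl t
    simp

/-- If `K = ∞` on a whole open half-line, then `1` or `-1` is a subgradient, because `K ≥ 0` on the
other side. -/
theorem mem_interior_effDom_of_subdifferential (hg : Measurable g)
    (h : subdifferential (fun t => (cgf φ g ν Ξ t : EReal)) 0 = {0}) :
    (0 : ℝ) ∈ interior (effDom (cgf φ g ν Ξ)) := by
  rw [Set.ext_iff] at h
  simp only [mem_subdifferential_cgf_iff hg, Set.mem_singleton_iff] at h
  refine (mem_interior_effDom_iff hg).2 ⟨?_, ?_⟩
  · by_contra! hcon
    refine one_ne_zero ((h 1).1 fun t => ?_)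
    rcases le_or_gt t 0 with ht | ht
    · rw [ENNReal.ofReal_of_nonpos (by linarith)]
      exact zero_le
    · exact le_top.trans (hcon t ht)
  · by_contra! hcon
    refine neg_ne_zero.2 one_ne_zero ((h (-1)).1 fun t => ?_)
    rcases le_or_gt 0 t with ht | ht
    · rw [ENNReal.ofReal_of_nonpos (by linarith)]
      exact zero_le
    · have := hcon (-t) (by linarith)
      rw [neg_neg] at this
      exact le_top.trans this

theorem hasFiniteDerivAt_cgf (hg : Measurable g)
    (hK : ∀ ε : ℝ, 0 < ε → ∃ t : ℝ, 0 < t ∧ cgf φ g ν Ξ t ≤ ENNReal.ofReal (ε * t))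
    (hK' : ∀ ε : ℝ, 0 < ε → ∃ t : ℝ, 0 < t ∧ cgf φ g ν Ξ (-t) ≤ ENNReal.ofReal (ε * t)) :
    HasFiniteDerivAt (cgf φ g ν Ξ) 0 0 := by
  have key : ∀ ε : ℝ, 0 < ε → ∀ᶠ s in 𝓝 (0 : ℝ), cgf φ g ν Ξ s ≤ ENNReal.ofReal (ε * |s|) := by
    intro ε hε
    obtain ⟨t, ht, h⟩ := hK ε hε
    obtain ⟨t', ht', h'⟩ := hK' ε hε
    filter_upwards [Ioo_mem_nhds (neg_lt_zero.2 ht') ht] with s hs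
    rcases le_total 0 s with h0 | h0
    · rw [abs_of_nonneg h0]
      exact cgf_le_of_le hg ht h h0 hs.2.le
    · rw [abs_of_nonpos h0]
      rw [← cgf_neg] at h'
      have h3 := cgf_le_of_le hg.neg ht' h' (s := -s) (by linarith) (by linarith [hs.1])
      change cgf φ (fun ω => -g ω) ν Ξ (-s) ≤ _ at h3
      rwa [cgf_neg, neg_neg] at h3
  refine ⟨(key 1 one_pos).mono fun s hs => hs.trans_lt ENNReal.ofReal_lt_top, ?_⟩
  rw [hasDerivAt_iff_isLittleO_nhds_zero, Asymptotics.isLittleO_iff]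
  intro ε hε
  filter_upwards [key ε hε] with s hs
  simp only [zero_add, cgf_zero hg, ENNReal.toReal_zero, sub_zero, smul_zero]
  rw [Real.norm_of_nonneg ENNReal.toReal_nonneg, Real.norm_eq_abs]
  exact ENNReal.toReal_le_of_le_ofReal (by positivity) hs

theorem essSide_of_cgf_lt_top (hc : slopeAtTop φ < ∞) (hg : Measurable g) {t : ℝ} (ht : 0 < t)
    (h : cgf φ g ν Ξ t < ∞) : ∃ M : ℝ, {ω | M < g ω} ∈ Ξ.sets := by
  obtain ⟨l, hl, -⟩ := exists_of_cgf_lt hg h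
  refine ⟨((slopeAtTop φ).toReal - l) / t,
    Ξ.subset_mem _ _ (measurableSet_lt measurable_const hg) (fun ω hω => ?_) hl⟩
  rw [Set.mem_ofPred_eq, div_lt_iff₀ ht] at hω
  exact (ENNReal.lt_ofReal_iff_toReal_lt hc.ne).2 (by linarith)

end Subdifferential

end PhiDivergence

end

/-! ### The equivalences -/

theorem mainTheorem6 {Ω : Type*} [MeasurableSpace Ω]
    (φ : ℝ → ℝ≥0∞)
    (hφ_convex : ConvexOn ℝ≥0 Set.univ φ)
    (hφ_lsc : LowerSemicontinuous φ)
    (hφ_one : φ 1 = 0)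
    (hφ_neg : ∀ x : ℝ, x < 0 → φ x = ∞)
    (hφ_dom : (1 : ℝ) ∈ interior {x : ℝ | φ x < ∞})
    (hφ_zero : (1 : ℝ) ∉ interior {x : ℝ | φ x = 0})
    (S : PhiDivergence.SigmaIdeal Ω)
    (g : Ω → ℝ) (hg : Measurable g)
    (ν : ProbabilityMeasure Ω) (hν : ν ∈ PhiDivergence.integratingProbs S g)
    (Ξ : PhiDivergence.SigmaIdeal Ω)
    (hΞ : Ξ = PhiDivergence.commonNullIdeal (PhiDivergence.integratingMeasures S g)) :
    List.TFAE
      [ -- convergence in divergence along measures that are null on `Ξ`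
        ∀ νs : ℕ → ProbabilityMeasure Ω, (∀ n, νs n ∈ PhiDivergence.acProb Ξ) →
          Tendsto (fun n => PhiDivergence.phiDiv φ (νs n) ν) atTop (𝓝 0) →
          (∀ᶠ n in atTop, Integrable g (νs n : Measure Ω)) ∧
            Tendsto (fun n => ∫ ω, g ω ∂(νs n : Measure Ω)) atTop
              (𝓝 (∫ ω, g ω ∂(ν : Measure Ω))),
        -- convergence in divergence along measures that integrate `g`
        ∀ νs : ℕ → ProbabilityMeasure Ω, (∀ n, νs n ∈ PhiDivergence.integratingProbs S g) →
          Tendsto (fun n => PhiDivergence.phiDiv φ (νs n) ν) atTop (𝓝 0) →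
          Tendsto (fun n => ∫ ω, g ω ∂(νs n : Measure Ω)) atTop
            (𝓝 (∫ ω, g ω ∂(ν : Measure Ω))),
        PhiDivergence.subdifferential
          (fun t => (PhiDivergence.cgf φ g ν Ξ t : EReal)) 0 = {0},
        PhiDivergence.HasFiniteDerivAt (PhiDivergence.cgf φ g ν Ξ) 0 0,
        (0 : ℝ) ∈ interior (PhiDivergence.effDom (PhiDivergence.cgf φ g ν Ξ)),
        (PhiDivergence.slopeAtTop φ < ∞ → PhiDivergence.EssBounded Ξ g) ∧
          (PhiDivergence.slopeAtTop φ = ∞ → PhiDivergence.Subexponential φ ν g) ] := by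
  open PhiDivergence in
  have hνi : Integrable g (ν : Measure Ω) := integrable_of_mem hg hν
  have hφm : Measurable φ := hφ_lsc.measurable
  have hsub : integratingProbs S g ⊆ acProb Ξ := hΞ ▸ integratingProbs_subset_acProb
  have hνΞ : ν ∈ acProb Ξ := hsub hν
  have hνneg : ν ∈ integratingProbs S (fun ω => -g ω) := by
    rwa [integratingProbs, integratingMeasures_neg]
  -- Condition 6 implies `K(±t) = o(t)`; both 1 and 4 rest on this.
  have hsmall : ((slopeAtTop φ < ∞ → EssBounded Ξ g) ∧
      (slopeAtTop φ = ∞ → Subexponential φ ν g)) →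
      (∀ ε : ℝ, 0 < ε → ∃ t : ℝ, 0 < t ∧ cgf φ g ν Ξ t ≤ ENNReal.ofReal (ε * t)) ∧
      ∀ ε : ℝ, 0 < ε → ∃ t : ℝ, 0 < t ∧ cgf φ g ν Ξ (-t) ≤ ENNReal.ofReal (ε * t) := by
    rintro ⟨hb, hs⟩
    simp only [← cgf_neg]
    rcases lt_or_eq_of_le (le_top : slopeAtTop φ ≤ ∞) with hc | hc
    · have hb' : EssBounded Ξ (fun ω => -g ω) := by
        obtain ⟨M, hM, h⟩ := (essBounded_iff hg).1 (hb hc)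
        exact (essBounded_iff hg.neg).2 ⟨M, hM, by simpa using h⟩
      exact ⟨fun ε => exists_cgf_le_of_essBounded hφ_convex hφ_one hφ_zero hc hg hνΞ (hb hc),
        fun ε => exists_cgf_le_of_essBounded hφ_convex hφ_one hφ_zero hc hg.neg hνΞ hb'⟩
    · have h := hs hc
      rw [Subexponential, cgf_eq_of_slope_eq_top hc Ξ, mem_interior_effDom_iff hg] at h
      obtain ⟨⟨t, ht, hK⟩, t', ht', hK'⟩ := h
      rw [← cgf_neg] at hK'
      exact ⟨fun ε => exists_cgf_le_of_slope_eq_top hφ_convex hφ_one hφ_neg hφ_zero hc hg hνi ht hK,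
        fun ε => exists_cgf_le_of_slope_eq_top hφ_convex hφ_one hφ_neg hφ_zero hc hg.neg hνi.neg
          ht' hK'⟩
  tfae_have 1 → 2 := fun h νs hνs hD => (h νs (fun n => hsub (hνs n)) hD).2
  tfae_have 2 → 6 := by
    intro h
    -- Condition 2 is symmetric under `g ↦ -g`, because `X_g` depends only on `|g|`; one-sided
    -- counterexamples therefore suffice.
    have hneg : ∀ νs : ℕ → ProbabilityMeasure Ω,
        (∀ n, νs n ∈ integratingProbs S (fun ω => -g ω)) →
        Tendsto (fun n => phiDiv φ (νs n) ν) atTop (𝓝 0) →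
        Tendsto (fun n => ∫ ω, -g ω ∂(νs n : Measure Ω)) atTop
          (𝓝 (∫ ω, -g ω ∂(ν : Measure Ω))) := by
      intro νs hνs hD
      simp only [integral_neg]
      refine (h νs (fun n => ?_) hD).neg
      have := hνs n
      rwa [integratingProbs, integratingMeasures_neg] at this
    refine ⟨fun hc => ?_, fun hc => ?_⟩
    · have key : ∀ f : Ω → ℝ, Measurable f → ν ∈ integratingProbs S f →
          (∀ νs : ℕ → ProbabilityMeasure Ω, (∀ n, νs n ∈ integratingProbs S f) →
            Tendsto (fun n => phiDiv φ (νs n) ν) atTop (𝓝 0) →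
            Tendsto (fun n => ∫ ω, f ω ∂(νs n : Measure Ω)) atTop
              (𝓝 (∫ ω, f ω ∂(ν : Measure Ω)))) →
          ∃ M : ℝ, {ω | M < f ω} ∈ (commonNullIdeal (integratingMeasures S f)).sets := by
        intro f hf hνf hT
        by_contra! hcon
        obtain ⟨νs, h1, h2, h3⟩ :=
          exists_not_tendsto_of_slope_lt_top hφ_convex hφ_one hφ_dom hf hνf hc hcon
        exact h3 (hT νs h1 h2)
      obtain ⟨M, hM⟩ := key g hg hν h
      obtain ⟨M', hM'⟩ := key _ hg.neg hνneg hneg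
      change {ω | M' < -g ω} ∈ (commonNullIdeal (integratingMeasures S fun ω => -g ω)).sets at hM'
      rw [integratingMeasures_neg, ← hΞ] at hM'
      rw [← hΞ] at hM
      exact essBounded_of_sides hg hM hM'
    · have key : ∀ f : Ω → ℝ, Measurable f → ν ∈ integratingProbs S f →
          (∀ νs : ℕ → ProbabilityMeasure Ω, (∀ n, νs n ∈ integratingProbs S f) →
            Tendsto (fun n => phiDiv φ (νs n) ν) atTop (𝓝 0) →
            Tendsto (fun n => ∫ ω, f ω ∂(νs n : Measure Ω)) atTop
              (𝓝 (∫ ω, f ω ∂(ν : Measure Ω)))) →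
          ∃ t : ℝ, 0 < t ∧ cgf φ f ν (nullIdeal (ν : Measure Ω)) t < ∞ := by
        intro f hf hνf hT
        by_contra! hcon
        obtain ⟨νs, h1, h2, h3⟩ := exists_not_tendsto_of_slope_eq_top hφ_convex hφ_lsc hφ_one hφ_neg
          hφ_dom hf hνf hc fun t ht => by
            -- If `K(t) = ∞`, the shift `l = 0`, admissible for infinite slope, already has infinite
            -- integral.
            refine top_le_iff.1 ((hcon t ht).trans ((cgf_le hf (l := 0) ?_).trans (by simp)))
            simp [hc, (nullIdeal (ν : Measure Ω)).empty_mem]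
        exact h3 (hT νs h1 h2)
      refine (mem_interior_effDom_iff hg).2 ⟨key g hg hν h, ?_⟩
      simp only [← cgf_neg]
      exact key _ hg.neg hνneg hneg
  tfae_have 6 → 1 := by
    intro h νs hνs hD
    obtain ⟨hK, hK'⟩ := hsmall h
    have hint : ∀ᶠ n in atTop, Integrable g (νs n : Measure Ω) := by
      obtain ⟨t, ht, h1⟩ := hK 1 one_pos
      obtain ⟨t', ht', h2⟩ := hK' 1 one_pos
      filter_upwards [hD.eventually_lt_const ENNReal.zero_lt_top] with n hn
      exact integrable_of_phiDiv_lt_top hφm hg hνi ht (h1.trans_lt ENNReal.ofReal_lt_top) ht'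
        (h2.trans_lt ENNReal.ofReal_lt_top) (hνs n) hn
    exact ⟨hint, tendsto_integral_of_phiDiv hφm hg hνi hK hK' hνs hint hD⟩
  tfae_have 6 → 4 := fun h => hasFiniteDerivAt_cgf hg (hsmall h).1 (hsmall h).2
  tfae_have 4 → 3 := subdifferential_cgf_of_hasFiniteDerivAt hg
  tfae_have 3 → 5 := mem_interior_effDom_of_subdifferential hg
  tfae_have 5 → 6 := by
    intro h
    refine ⟨fun hc => ?_, fun hc => ?_⟩
    · obtain ⟨⟨t, ht, h1⟩, t', ht', h2⟩ := (mem_interior_effDom_iff hg).1 h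
      rw [← cgf_neg] at h2
      obtain ⟨M, hM⟩ := essSide_of_cgf_lt_top hc hg ht h1
      obtain ⟨M', hM'⟩ := essSide_of_cgf_lt_top hc hg.neg ht' h2
      exact essBounded_of_sides hg hM hM'
    · rwa [Subexponential, cgf_eq_of_slope_eq_top hc Ξ]
  tfae_finish
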